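/- **Setting.** For points of the plane, $p$ *dominates* $q$ if both coordinates of $p$ are at least those of $q$; $p$ dominates a rectangle if it dominates its top right vertex. Let $\mathcal O$ be a finite family of pairwise disjoint closed axis-aligned rectangles $O_i$ (single points are allowed as degenerate rectangles), and let $P$ consist of one point $p_i\in O_i$ for each $i$, in general position: no vertices or points share an $x$- or a $y$-coordinate, apart from the coincidences forced within one rectangle. Let $C\ge 0$ be the retrieval cost; $\log$ is base 2. **Truncation.** A region of a family is *negative* if for every choice of points in the regions its point is dominated by another one. $\mathit{Trunc}$ removes the negative regions, and replaces every other region by its part that does not lie strictly below the *guaranteed boundary*, the Pareto front of the bottom left vertices; this part is a rectangle. A region whose bottom left vertex lay strictly below the boundary is *flagged*. Let $\mathcal R=(R_1,\dots,R_n)=\mathit{Trunc}(\mathcal O)$, indexed by the order of the bottom left vertices from top left to bottom right (points are re-indexed accordingly). **Dependency graph.** In the graph $G(\mathcal S)$ of such an ordered family, a region has a vertical arrow to each succeeding region that is vertically visible from it (some vertical segment joins the two without meeting another region; mere contact of their sides with a common vertical line does not count), and a horizontal arrow to each preceding region that is horizontally visible from it. Sources and sinks are the regions without incoming and without outgoing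 arrows. $[S_i,S_j]$, $i<j$, is a *subproblem* of $G(\mathcal S)$ if $S_i$ and $S_j$ are sources with no source strictly between them. **Cost function.** $V_i(P)$ consists of $R_i$ and the regions to which $R_i$ has a vertical arrow in $G(\mathcal R)$ and that are dominated by some $p_j$ with $j\le i$; $H_i(P)$ consists of $R_i$ and the regions to which $R_i$ has a horizontal arrow and that are dominated by some $p_j$ with $j\ge i$. The Pareto front of $P$ is the boundary of the set of points dominated by a point of $P$; its edges run downwards and to the left from the points of $P$ on it. $\tilde{\mathcal R}(P)$ is the set of those $R_i\in\mathcal R$ that are intersected by the Pareto front of $P$ and that are flagged, or intersect an edge of the front with an endpoint $p_j$, $j\neq i$, or are not a sink of $G(\mathcal R)$. Put $$\mathrm{CP}(\mathcal R,P)=\sum_{R_i\in\tilde{\mathcal R}(P)}\bigl(C+\log|V_i(P)|+\log|H_i(P)|\bigr).$$ **Canonical set.** $\mathcal R^\star$ arises from $\mathcal R$ by deleting all regions that are both a source and a sink of $G(\mathcal R)$ and then replacing each maximal sequence of consecutive sinks by the smallest rectangle containing it (a *compound region*, if the sequence has at least two members). **Algorithm.** A queue initially holds the subproblems of $G(\mathcal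 R^\star)$, in any order. In each iteration the first subproblem $[R_i,R_j]$ is dequeued, and $R_i$ and $R_j$ are processed. Let $\mathcal R'$ be obtained from $\mathcal R^\star$ by replacing every region processed so far by its point (compound regions stay in place) and truncating. The subproblems of $G(\mathcal R'\cap[R_i,R_j])$, where $R_i$ and $R_j$ themselves count as sources, are appended to the queue in any order, except $[R_i,R_j]$ itself. (Intervals are taken in the order of $\mathcal R^\star$.) Let $\mathcal R^{A1}(\mathcal R^\star,P)\subseteq\mathcal R^\star$ be the set of all ends $R_i,R_j$ of subproblems dequeued in some iteration with $i<j-1$, where $i,j$ are the indices in $\mathcal R^\star$. **Theorem.** For every execution of the algorithm on $\mathcal R^\star$, $$A(\mathcal R,\mathcal R^\star,P)=\sum_{R_i\in\mathcal R^{A1}(\mathcal R^\star,P)}\Bigl(\tfrac12C+\log|V_i(P)|+\log|H_i(P)|\Bigr)\le\mathrm{CP}(\mathcal R,P),$$ where $V_i(P)$ and $H_i(P)$ refer to subsets of $\mathcal R$, not of $\mathcal R^\star$. For a compound region $K\in\mathcal R^{A1}(\mathcal R^\star,P)$ these sets consist of $K$ itself, counted as one region, and of the regions outside $K$ in the corresponding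 sets of the members of $K$. -/

import Mathlib

/-! Points of the plane are elements of `ℝ × ℝ`; `q ≤ p` in the product order says exactly that
`p` (Pareto) dominates `q`. -/

/-- A closed axis-aligned rectangle with bottom left vertex `lo` and top right vertex `hi`;
a point `p` is the degenerate rectangle with `lo = hi = p`. -/
structure Rect where
  lo : ℝ × ℝ
  hi : ℝ × ℝ
  le : lo ≤ hi

/-- The set of points of a rectangle. -/
def Rect.carrier (r : Rect) : Set (ℝ × ℝ) := Set.Icc r.lo r.hi

/-- A point as a degenerate rectangle. -/
def Rect.point (p : ℝ × ℝ) : Rect := ⟨p, p, le_rfl⟩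

/-- A finite family of rectangles: the rectangles `rect i` for the names `i ∈ idx`. -/
structure RegionSet (ι : Type*) where
  idx : Finset ι
  rect : ι → Rect

namespace RegionSet

section Basics

variable {ι : Type*}

/-- The regions are pairwise disjoint. -/
def PairwiseDisjoint (S : RegionSet ι) : Prop :=
  ∀ i ∈ S.idx, ∀ j ∈ S.idx, i ≠ j → Disjoint (S.rect i).carrier (S.rect j).carrier

/-- `P` respects `S`: each point lies in its region. -/
def Respects (S : RegionSet ι) (P : ι → ℝ × ℝ) : Prop :=
  ∀ i ∈ S.idx, P i ∈ (S.rect i).carrier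

/-- General position of the regions and the points: each region is a single point or has positive
width and height, and no two of the vertices and points share an `x`- or a `y`-coordinate
(apart from the coincidences that are forced within one region). -/
structure GeneralPosition (S : RegionSet ι) (P : ι → ℝ × ℝ) : Prop where
  shape : ∀ i ∈ S.idx, (S.rect i).lo = (S.rect i).hi ∨
    ((S.rect i).lo.1 < (S.rect i).hi.1 ∧ (S.rect i).lo.2 < (S.rect i).hi.2)
  own : ∀ i ∈ S.idx, (S.rect i).lo = (S.rect i).hi ∨
    ((P i).1 ≠ (S.rect i).lo.1 ∧ (P i).1 ≠ (S.rect i).hi.1 ∧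
      (P i).2 ≠ (S.rect i).lo.2 ∧ (P i).2 ≠ (S.rect i).hi.2)
  xcoord : ∀ i ∈ S.idx, ∀ j ∈ S.idx, i ≠ j →
    Disjoint ({(S.rect i).lo.1, (S.rect i).hi.1, (P i).1} : Set ℝ)
      {(S.rect j).lo.1, (S.rect j).hi.1, (P j).1}
  ycoord : ∀ i ∈ S.idx, ∀ j ∈ S.idx, i ≠ j →
    Disjoint ({(S.rect i).lo.2, (S.rect i).hi.2, (P i).2} : Set ℝ)
      {(S.rect j).lo.2, (S.rect j).hi.2, (P j).2}

/-! ### Truncation -/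

/-- `i` is a negative region: for every choice of points in the regions, the point of `i` is
dominated by another point, i.e. it is not on the Pareto front. -/
def IsNegative (S : RegionSet ι) (i : ι) : Prop :=
  ∀ p : ι → ℝ × ℝ, S.Respects p → ∃ j ∈ S.idx, j ≠ i ∧ p i ≤ p j

theorem isNegative_iff (S : RegionSet ι) {i : ι} (hi : i ∈ S.idx) :
    S.IsNegative i ↔ ∃ j ∈ S.idx, j ≠ i ∧ (S.rect i).hi ≤ (S.rect j).lo := by
  classical
  constructor
  · intro h
    obtain ⟨j, hj, hji, hle⟩ := h (fun k => if k = i then (S.rect k).hi else (S.rect k).lo) (by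
      intro k _
      by_cases hk : k = i
      · simp [hk, Rect.carrier, (S.rect i).le]
      · simp [hk, Rect.carrier, (S.rect k).le])
    refine ⟨j, hj, hji, ?_⟩
    simpa [hji] using hle
  · rintro ⟨j, hj, hji, hle⟩ p hp
    exact ⟨j, hj, hji, ((hp i hi).2.trans hle).trans (hp j hj).1⟩

/-- `z` lies (strictly) below the guaranteed boundary, the Pareto front of the bottom left vertices
of the regions. -/
def BelowBoundary (S : RegionSet ι) (z : ℝ × ℝ) : Prop :=
  ∃ j ∈ S.idx, z.1 < (S.rect j).lo.1 ∧ z.2 < (S.rect j).lo.2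

open scoped Classical in
/-- The part of a non-negative region that is not below the guaranteed boundary, as a rectangle
(see `carrier_cut`): its left side is moved to the rightmost vertical edge of the boundary that
cuts it, and its bottom side is moved up to the highest horizontal edge that cuts it. -/
noncomputable def cut (S : RegionSet ι) (i : ι) : Rect where
  lo :=
    ((insert i (S.idx.filter fun j =>
        (S.rect j).lo.1 ≤ (S.rect i).hi.1 ∧ (S.rect i).hi.2 ≤ (S.rect j).lo.2)).sup'
        (Finset.insert_nonempty _ _) (fun j => (S.rect j).lo.1),
      (insert i (S.idx.filter fun j =>
        (S.rect j).lo.2 ≤ (S.rect i).hi.2 ∧ (S.rect i).hi.1 ≤ (S.rect j).lo.1)).sup'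
        (Finset.insert_nonempty _ _) (fun j => (S.rect j).lo.2))
  hi := (S.rect i).hi
  le := by
    constructor
    · refine Finset.sup'_le (Finset.insert_nonempty _ _) _ fun j hj => ?_
      rcases Finset.mem_insert.1 hj with rfl | hj
      · exact (S.rect j).le.1
      · exact (Finset.mem_filter.1 hj).2.1
    · refine Finset.sup'_le (Finset.insert_nonempty _ _) _ fun j hj => ?_
      rcases Finset.mem_insert.1 hj with rfl | hj
      · exact (S.rect j).le.2
      · exact (Finset.mem_filter.1 hj).2.1

/-- The rectangle `S.cut i` is the part of a non-negative region above the guaranteed boundary. -/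
theorem carrier_cut (S : RegionSet ι) (hS : S.PairwiseDisjoint) {i : ι} (hi : i ∈ S.idx)
    (hn : ¬ S.IsNegative i) :
    (S.cut i).carrier = {z ∈ (S.rect i).carrier | ¬ S.BelowBoundary z} := by
  classical
  have hnot : ∀ j ∈ S.idx, j ≠ i → ¬ (S.rect j).lo ∈ (S.rect i).carrier := fun j hj hji h =>
    Set.disjoint_left.1 (hS i hi j hj hji.symm) h ⟨le_rfl, (S.rect j).le⟩
  rw [isNegative_iff S hi] at hn
  ext z
  constructor
  · rintro ⟨⟨h1, h2⟩, h3⟩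
    have a1 := (Finset.sup'_le_iff (Finset.insert_nonempty _ _) _).1 h1
    have a2 := (Finset.sup'_le_iff (Finset.insert_nonempty _ _) _).1 h2
    refine ⟨⟨⟨a1 i (Finset.mem_insert_self _ _), a2 i (Finset.mem_insert_self _ _)⟩, h3⟩, ?_⟩
    rintro ⟨j, hj, hz1, hz2⟩
    have b1 := a1 i (Finset.mem_insert_self _ _)
    have b2 := a2 i (Finset.mem_insert_self _ _)
    have hji : j ≠ i := by rintro rfl; exact absurd b1 (not_le.2 hz1)
    by_cases c1 : (S.rect j).lo.1 ≤ (S.rect i).hi.1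
    · by_cases c2 : (S.rect i).hi.2 ≤ (S.rect j).lo.2
      · exact absurd (a1 j (Finset.mem_insert_of_mem (Finset.mem_filter.2 ⟨hj, c1, c2⟩)))
          (not_le.2 hz1)
      · exact hnot j hj hji ⟨⟨b1.trans hz1.le, b2.trans hz2.le⟩, ⟨c1, (not_le.1 c2).le⟩⟩
    · by_cases c2 : (S.rect j).lo.2 ≤ (S.rect i).hi.2
      · exact absurd (a2 j (Finset.mem_insert_of_mem
          (Finset.mem_filter.2 ⟨hj, c2, (not_le.1 c1).le⟩))) (not_le.2 hz2)
      · exact hn ⟨j, hj, hji, (not_le.1 c1).le, (not_le.1 c2).le⟩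
  · rintro ⟨⟨h1, h2⟩, h3⟩
    refine ⟨⟨Finset.sup'_le (Finset.insert_nonempty _ _) _ fun j hj => ?_,
      Finset.sup'_le (Finset.insert_nonempty _ _) _ fun j hj => ?_⟩, h2⟩
    · by_contra hlt
      have hlt := not_le.1 hlt
      rcases Finset.mem_insert.1 hj with rfl | hj
      · exact absurd h1.1 (not_le.2 hlt)
      obtain ⟨hj, c1, c2⟩ := Finset.mem_filter.1 hj
      have hji : j ≠ i := by rintro rfl; exact absurd h1.1 (not_le.2 hlt)
      rcases (h2.2.trans c2).lt_or_eq with h | h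
      · exact h3 ⟨j, hj, hlt, h⟩
      · exact hnot j hj hji ⟨⟨h1.1.trans hlt.le, h1.2.trans h.le⟩, ⟨c1, h ▸ h2.2⟩⟩
    · by_contra hlt
      have hlt := not_le.1 hlt
      rcases Finset.mem_insert.1 hj with rfl | hj
      · exact absurd h1.2 (not_le.2 hlt)
      obtain ⟨hj, c1, c2⟩ := Finset.mem_filter.1 hj
      have hji : j ≠ i := by rintro rfl; exact absurd h1.2 (not_le.2 hlt)
      rcases (h2.1.trans c2).lt_or_eq with h | h
      · exact h3 ⟨j, hj, h, hlt⟩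
      · exact hnot j hj hji ⟨⟨h1.1.trans h.le, h1.2.trans hlt.le⟩, ⟨h ▸ h2.1, c1⟩⟩

open scoped Classical in
/-- The truncation: negative regions are removed, and every other region is replaced by its part
above the guaranteed boundary (which is the region itself if it does not reach below it). -/
noncomputable def trunc (S : RegionSet ι) : RegionSet ι where
  idx := S.idx.filter fun i => ¬ S.IsNegative i
  rect := S.cut

/-- The region `i` of `S.trunc` is flagged: the bottom left vertex of the untruncated region lies
below the guaranteed boundary. -/
def IsFlagged (S : RegionSet ι) (i : ι) : Prop :=
  i ∈ S.trunc.idx ∧ S.BelowBoundary (S.rect i).lo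

/-! ### The order of the regions and the dependency graph -/

/-- The region `i` precedes the region `j` in the order of the bottom left vertices from top left
to bottom right; on a truncated set, this is the order of the indices. -/
def Before (S : RegionSet ι) (i j : ι) : Prop :=
  i ∈ S.idx ∧ j ∈ S.idx ∧ (S.rect i).lo.1 ≤ (S.rect j).lo.1 ∧
    (S.rect j).lo.2 ≤ (S.rect i).lo.2 ∧ (S.rect i).lo ≠ (S.rect j).lo

/-- Vertical arrow: `k` succeeds `i`, and some vertical segment connects the two regions without
meeting another one. The two strict inequalities say that the regions do not merely touch a
common vertical line with their sides; so a point region has no outgoing arrow to a region that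
has been cut off at that point. -/
def VArrow (S : RegionSet ι) (i k : ι) : Prop :=
  S.Before i k ∧ (S.rect i).lo.1 < (S.rect k).hi.1 ∧ (S.rect k).lo.1 < (S.rect i).hi.1 ∧
    ∃ x y y' : ℝ, (x, y) ∈ (S.rect i).carrier ∧ (x, y') ∈ (S.rect k).carrier ∧
      ∀ l ∈ S.idx, l ≠ i → l ≠ k → ∀ t ∈ Set.uIcc y y', (x, t) ∉ (S.rect l).carrier

/-- Horizontal arrow: `k` precedes `i`, and some horizontal segment connects the two regions
without meeting another one. -/
def HArrow (S : RegionSet ι) (i k : ι) : Prop :=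
  S.Before k i ∧ (S.rect i).lo.2 < (S.rect k).hi.2 ∧ (S.rect k).lo.2 < (S.rect i).hi.2 ∧
    ∃ x x' y : ℝ, (x, y) ∈ (S.rect i).carrier ∧ (x', y) ∈ (S.rect k).carrier ∧
      ∀ l ∈ S.idx, l ≠ i → l ≠ k → ∀ t ∈ Set.uIcc x x', (t, y) ∉ (S.rect l).carrier

/-- An arrow of the dependency graph. -/
def Arrow (S : RegionSet ι) (i k : ι) : Prop := S.VArrow i k ∨ S.HArrow i k

/-- A region without incoming arrow. -/
def IsSource (S : RegionSet ι) (i : ι) : Prop := i ∈ S.idx ∧ ∀ k, ¬ S.Arrow k i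

/-- A region without outgoing arrow. -/
def IsSink (S : RegionSet ι) (i : ι) : Prop := i ∈ S.idx ∧ ∀ k, ¬ S.Arrow i k

/-- `[i, j]` is a subproblem: `i` and `j` are consecutive sources. -/
def IsSubproblem (S : RegionSet ι) (i j : ι) : Prop :=
  S.Before i j ∧ S.IsSource i ∧ S.IsSource j ∧
    ∀ k, S.Before i k → S.Before k j → ¬ S.IsSource k

/-! ### The Pareto cost function

In this part `O` is the original set and `O.trunc` the truncated set. -/

open scoped Classical in
/-- `V_i(P)` for a truncated set `R`: the region `i`, together with the regions vertically visible
from `i` among its successors that are dominated by a point of `i` or of a predecessor of `i`. -/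
noncomputable def vSet (R : RegionSet ι) (P : ι → ℝ × ℝ) (i : ι) : Finset ι :=
  insert i (R.idx.filter fun k =>
    R.VArrow i k ∧ ∃ j ∈ R.idx, (j = i ∨ R.Before j i) ∧ (R.rect k).hi ≤ P j)

open scoped Classical in
/-- `H_i(P)` for a truncated set `R`: the region `i`, together with the regions horizontally visible
from `i` among its predecessors that are dominated by a point of `i` or of a successor of `i`. -/
noncomputable def hSet (R : RegionSet ι) (P : ι → ℝ × ℝ) (i : ι) : Finset ι :=
  insert i (R.idx.filter fun k =>
    R.HArrow i k ∧ ∃ j ∈ R.idx, (j = i ∨ R.Before i j) ∧ (R.rect k).hi ≤ P j)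

/-- The Pareto front: the boundary of the set of points that are dominated by a point of `P`. -/
def paretoFront (O : RegionSet ι) (P : ι → ℝ × ℝ) : Set (ℝ × ℝ) :=
  frontier {z | ∃ j ∈ O.idx, z ≤ P j}

/-- `z` lies on an edge of the Pareto front that has `P j` as an endpoint: the vertical edge going
down from `P j` or the horizontal edge going left from `P j`. -/
def OnEdgeOf (O : RegionSet ι) (P : ι → ℝ × ℝ) (j : ι) (z : ℝ × ℝ) : Prop :=
  P j ∈ O.paretoFront P ∧ z ∈ O.paretoFront P ∧ z ≤ P j ∧ (z.1 = (P j).1 ∨ z.2 = (P j).2)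

/-- Membership in `R̃(P)`, for the truncated set `O.trunc`: the Pareto front intersects the region
`i`, and `i` is flagged, or intersects an edge that ends in the point of another region, or is not
a sink. -/
def IsInteresting (O : RegionSet ι) (P : ι → ℝ × ℝ) (i : ι) : Prop :=
  i ∈ O.trunc.idx ∧ ((O.trunc.rect i).carrier ∩ O.paretoFront P).Nonempty ∧
    (O.IsFlagged i ∨
      (∃ j ∈ O.idx, j ≠ i ∧ ∃ z ∈ (O.trunc.rect i).carrier, O.OnEdgeOf P j z) ∨
      ¬ O.trunc.IsSink i)

open scoped Classical in
/-- The Pareto cost function `CP(O.trunc, P)` for the retrieval cost `C`. -/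
noncomputable def paretoCost (O : RegionSet ι) (P : ι → ℝ × ℝ) (C : ℝ) : ℝ :=
  ∑ i ∈ O.trunc.idx.filter (O.IsInteresting P),
    (C + Real.logb 2 (O.trunc.vSet P i).card + Real.logb 2 (O.trunc.hSet P i).card)

/-! ### The canonical set -/

open scoped Classical in
/-- Remove all regions that are both a source and a sink. -/
noncomputable def culled (S : RegionSet ι) : RegionSet ι where
  idx := S.idx.filter fun i => ¬ (S.IsSource i ∧ S.IsSink i)
  rect := S.rect

/-- `k` is `i`, or `j`, or lies between them in the order of the regions. -/
def Between (S : RegionSet ι) (i j k : ι) : Prop :=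
  k = i ∨ k = j ∨ (S.Before i k ∧ S.Before k j) ∨ (S.Before j k ∧ S.Before k i)

open scoped Classical in
/-- The maximal sequence of consecutive sinks that contains `i` if `i` is a sink; the singleton
`{i}` otherwise. -/
noncomputable def block (S : RegionSet ι) (i : ι) : Finset ι :=
  if S.IsSink i then
    S.idx.filter fun j => ∀ k ∈ S.idx, S.Between i j k → S.IsSink k
  else {i}

open scoped Classical in
/-- The smallest rectangle that contains all regions in `B`. -/
noncomputable def hull (S : RegionSet ι) (B : Finset ι) : Rect :=
  if h : B.Nonempty then
    { lo := B.inf' h fun i => (S.rect i).lo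
      hi := B.sup' h fun i => (S.rect i).hi
      le := by
        obtain ⟨i, hi⟩ := h
        exact (Finset.inf'_le _ hi).trans ((S.rect i).le.trans
          (Finset.le_sup' (fun i => (S.rect i).hi) hi)) }
  else Rect.point 0

open scoped Classical in
/-- The canonical set of a truncated set: after culling, each maximal sequence of sinks is replaced
by one compound region. A region of the canonical set is named by the set of the regions that
it consists of, so by `{i}` if it is not a proper compound. -/
noncomputable def canonical (R : RegionSet ι) : RegionSet (Finset ι) where
  idx := R.culled.idx.image R.culled.block
  rect := R.culled.hull

end Basics

/-! ### The algorithm -/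

section Algorithm

variable {ι : Type*}

open scoped Classical in
/-- The current truncated set when the regions in `D` of the canonical set `K` have been processed:
a processed region is replaced by its point, and the result is truncated. A proper compound
region is represented by a stored chain rather than by a single point, and stays in place. -/
noncomputable def current (K : RegionSet (Finset ι)) (P : ι → ℝ × ℝ) (D : Finset (Finset ι)) :
    RegionSet (Finset ι) :=
  trunc
    { idx := K.idx
      rect := fun B => if h : B ∈ D ∧ ∃ i, B = {i} then Rect.point (P h.2.choose) else K.rect B }

open scoped Classical in
/-- The regions of `S` that belong to the interval `[a, b]` of `K`. -/
noncomputable def interval (K S : RegionSet (Finset ι)) (a b : Finset ι) :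
    RegionSet (Finset ι) where
  idx := S.idx.filter fun B => B = a ∨ B = b ∨ (K.Before a B ∧ K.Before B b)
  rect := S.rect

/-- `[c, d]` is a subproblem of the dependency graph of the part of `S` in `[a, b]`, where `a` and
`b` have just been processed. The ends `a` and `b` count as sources. -/
def IsChild (K S : RegionSet (Finset ι)) (a b c d : Finset ι) : Prop :=
  (c = a ∨ (K.Before a c ∧ K.Before c b ∧ (interval K S a b).IsSource c)) ∧
  (d = b ∨ (K.Before a d ∧ K.Before d b ∧ (interval K S a b).IsSource d)) ∧
  K.Before c d ∧
  ∀ k, K.Before c k → K.Before k d → ¬ (interval K S a b).IsSource k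

/-- A state of the algorithm: the processed regions and the queue of subproblems. -/
structure AlgState (ι : Type*) where
  processed : Finset (Finset ι)
  queue : List (Finset ι × Finset ι)

open scoped Classical in
/-- One iteration. If the queue is empty, the algorithm has stopped. Otherwise the first
subproblem `[a, b]` is dequeued, `a` and `b` are processed, and the new subproblems inside `[a, b]`
are appended in any order; `[a, b]` itself, whose two ends are already processed, is not queued
again. -/
def IsStep (K : RegionSet (Finset ι)) (P : ι → ℝ × ℝ) (s s' : AlgState ι) : Prop :=
  (s.queue = [] ∧ s' = s) ∨
  ∃ (a b : Finset ι) (Q new : List (Finset ι × Finset ι)),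
    s.queue = (a, b) :: Q ∧
    s'.processed = s.processed ∪ {a, b} ∧
    s'.queue = Q ++ new ∧
    new.Nodup ∧
    ∀ c d, (c, d) ∈ new ↔
      IsChild K (current K P (s.processed ∪ {a, b})) a b c d ∧ (c, d) ≠ (a, b)

/-- `s 0, s 1, …` are the states of an execution of the algorithm on the canonical set `K`. The
queue initially holds the subproblems of `K`, in any order. -/
def IsExecution (K : RegionSet (Finset ι)) (P : ι → ℝ × ℝ) (s : ℕ → AlgState ι) : Prop :=
  (s 0).processed = ∅ ∧
  (s 0).queue.Nodup ∧ (∀ a b, (a, b) ∈ (s 0).queue ↔ K.IsSubproblem a b) ∧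
  ∀ t, IsStep K P (s t) (s (t + 1))

/-- `B` belongs to `R^{A1}`: it is an end of a subproblem `[a, b]` that is considered in some
iteration and that has a region of `K` strictly between its ends. -/
def IsEndpoint (K : RegionSet (Finset ι)) (s : ℕ → AlgState ι) (B : Finset ι) : Prop :=
  ∃ (t : ℕ) (a b : Finset ι), (s t).queue.head? = some (a, b) ∧
    (∃ k, K.Before a k ∧ K.Before k b) ∧ (B = a ∨ B = b)

open scoped Classical in
/-- `|V_B(P)|` for a region `B` of the canonical set, counted in the truncated set `R`: the region
`B` itself counts once, and so does each other region of `R` in some `V_i(P)`, `i ∈ B`. -/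
noncomputable def vCard (R : RegionSet ι) (P : ι → ℝ × ℝ) (B : Finset ι) : ℕ :=
  1 + (B.biUnion (R.vSet P) \ B).card

open scoped Classical in
/-- `|H_B(P)|` for a region `B` of the canonical set, counted in the truncated set `R`. -/
noncomputable def hCard (R : RegionSet ι) (P : ι → ℝ × ℝ) (B : Finset ι) : ℕ :=
  1 + (B.biUnion (R.hSet P) \ B).card

theorem vCard_singleton (R : RegionSet ι) (P : ι → ℝ × ℝ) (i : ι) :
    R.vCard P {i} = (R.vSet P i).card := by
  classical
  have h : i ∈ R.vSet P i := by simp [vSet]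
  have := Finset.card_pos.2 ⟨i, h⟩
  simp only [vCard, Finset.singleton_biUnion, Finset.sdiff_singleton_eq_erase]
  rw [Finset.card_erase_of_mem h]
  omega

theorem hCard_singleton (R : RegionSet ι) (P : ι → ℝ × ℝ) (i : ι) :
    R.hCard P {i} = (R.hSet P i).card := by
  classical
  have h : i ∈ R.hSet P i := by simp [hSet]
  have := Finset.card_pos.2 ⟨i, h⟩
  simp only [hCard, Finset.singleton_biUnion, Finset.sdiff_singleton_eq_erase]
  rw [Finset.card_erase_of_mem h]
  omega

open scoped Classical in
/-- The quantity `A(R, R*, P)` for the truncated set `R = O.trunc`, its canonical set `R*`, and the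
execution `s` of the algorithm on `R*`. -/
noncomputable def algCost (O : RegionSet ι) (P : ι → ℝ × ℝ) (C : ℝ) (s : ℕ → AlgState ι) : ℝ :=
  ∑ B ∈ O.trunc.canonical.idx.filter (IsEndpoint O.trunc.canonical s),
    (C / 2 + Real.logb 2 (O.trunc.vCard P B) + Real.logb 2 (O.trunc.hCard P B))

end Algorithm

end RegionSet

/-!
The cost of the algorithm is compared with the Pareto cost separately for the logarithms and for
the retrieval costs, through a set of *good* regions (`Config.Good`): the single regions of the
canonical set that are not sinks and whose top right vertex is not dominated by the point of another
region. A good region meets the Pareto front, so it occurs in the Pareto cost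
(`Config.Good.isInteresting`). The theorem follows from two facts about the ends of the subproblems
that the algorithm considers.

* *No end is dominated as a whole* (`IsExecution.undominated_and_rooted`). Arrows come from
  overlaps: a region is a source exactly if no other region overlaps it from its own side of the order
  (`isSource_iff`), since the nearest overlapping region is visible. A point that dominates `c` and
  lies on the Pareto front belongs to a region overlapping `c`. Hence either this region, still
  unprocessed, keeps `c` from being a source, or its revealed point makes `c` negative. To exclude
  that it lies outside the current interval, the invariant `Settled` also records that every point
  reaching over an end of a subproblem is in the shadow of an already revealed one.
* *The sinks among the ends are at most as many as the good regions*
  (`card_le_card_of_interleaved`). Every end that is a sink comes after a source of the canonical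
  set, which is a good region since isolated regions have been removed (`Blocks.not_isSource`). Two
  ends `x`, `y` that are sinks, or compound, are separated by a region that is not a sink, by
  maximality of the compound regions. If it is not good, then it is dominated by the point of a good
  region; that region lies between `x` and `y` too, as otherwise its point would dominate `x` or `y`
  (`Config.exists_good_between`).

An end that is not a sink is good and pays for its logarithms and half of its retrieval cost. An end
that is a sink has no logarithmic cost, and its half retrieval cost is charged to the second half of
the retrieval cost of a good region.

Horizontal statements are obtained from vertical ones by reflection in the diagonal (`swap`).
-/

/-! ### Reflection in the diagonal -/

/-- The reflection of a rectangle in the diagonal `x = y`. -/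
def Rect.swap (r : Rect) : Rect := ⟨r.lo.swap, r.hi.swap, ⟨r.le.2, r.le.1⟩⟩

namespace RegionSet

variable {ι : Type*}

/-- The reflection of a family of rectangles in the diagonal `x = y`. It reverses the order of the
regions, and exchanges vertical and horizontal arrows. -/
def swap (S : RegionSet ι) : RegionSet ι := ⟨S.idx, fun i => (S.rect i).swap⟩

theorem before_swap {S : RegionSet ι} {i j : ι} : S.swap.Before i j ↔ S.Before j i := by
  simp only [Before, swap, Rect.swap, Prod.fst_swap, Prod.snd_swap, ne_eq]
  rw [Prod.swap_injective.eq_iff]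
  tauto

theorem mem_carrier_swap {r : Rect} {x y : ℝ} : (x, y) ∈ r.swap.carrier ↔ (y, x) ∈ r.carrier := by
  simp only [Rect.carrier, Rect.swap, Set.mem_Icc, Prod.le_def, Prod.fst_swap, Prod.snd_swap]
  tauto

theorem hArrow_iff_swap {S : RegionSet ι} {i k : ι} : S.HArrow i k ↔ S.swap.VArrow i k := by
  rw [HArrow, VArrow, before_swap]
  simp only [mem_carrier_swap, swap]
  refine and_congr_right fun _ => and_congr_right fun _ => and_congr_right fun _ => ?_
  constructor
  · rintro ⟨x, x', y, h⟩
    exact ⟨y, x, x', h⟩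
  · rintro ⟨y, x, x', h⟩
    exact ⟨x, x', y, h⟩

theorem vArrow_iff_swap {S : RegionSet ι} {i k : ι} : S.VArrow i k ↔ S.swap.HArrow i k := by
  rw [hArrow_iff_swap]
  rfl

theorem arrow_swap {S : RegionSet ι} {i k : ι} : S.swap.Arrow i k ↔ S.Arrow i k := by
  rw [Arrow, Arrow, ← vArrow_iff_swap, ← hArrow_iff_swap, or_comm]

theorem isSource_swap {S : RegionSet ι} {i : ι} : S.swap.IsSource i ↔ S.IsSource i := by
  simp only [IsSource, arrow_swap]
  rfl

theorem isSink_swap {S : RegionSet ι} {i : ι} : S.swap.IsSink i ↔ S.IsSink i := by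
  simp only [IsSink, arrow_swap]
  rfl

theorem disjoint_carrier {r s : Rect} : Disjoint r.carrier s.carrier ↔
    r.hi.1 < s.lo.1 ∨ s.hi.1 < r.lo.1 ∨ r.hi.2 < s.lo.2 ∨ s.hi.2 < r.lo.2 := by
  have h1 := r.le.1
  have h2 := r.le.2
  have h3 := s.le.1
  have h4 := s.le.2
  constructor
  · intro h
    by_contra! hc
    obtain ⟨c1, c2, c3, c4⟩ := hc
    refine Set.not_disjoint_iff.2 ⟨(max r.lo.1 s.lo.1, max r.lo.2 s.lo.2), ?_, ?_⟩ h <;>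
      simp [Rect.carrier, Prod.le_def, *]
  · intro h
    refine Set.disjoint_left.2 fun z hz hz' => ?_
    obtain ⟨⟨a1, a2⟩, a3, a4⟩ := hz
    obtain ⟨⟨b1, b2⟩, b3, b4⟩ := hz'
    rcases h with h | h | h | h <;> linarith

/-! ### The order of the regions -/

theorem Before.trans {S : RegionSet ι} {i j k : ι} (h : S.Before i j) (h' : S.Before j k) :
    S.Before i k := by
  refine ⟨h.1, h'.2.1, h.2.2.1.trans h'.2.2.1, h'.2.2.2.1.trans h.2.2.2.1, fun e => h.2.2.2.2 ?_⟩
  refine Prod.ext (le_antisymm h.2.2.1 (e ▸ h'.2.2.1)) (le_antisymm ?_ h.2.2.2.1)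
  rw [e]
  exact h'.2.2.2.1

theorem Before.asymm {S : RegionSet ι} {i j : ι} (h : S.Before i j) : ¬ S.Before j i :=
  fun h' => h.2.2.2.2 (Prod.ext (le_antisymm h.2.2.1 h'.2.2.1) (le_antisymm h'.2.2.2.1 h.2.2.2.1))

theorem Before.ne {S : RegionSet ι} {i j : ι} (h : S.Before i j) : i ≠ j := by
  rintro rfl
  exact h.2.2.2.2 rfl

/-- The regions are totally ordered from top left to bottom right. -/
def Ordered (S : RegionSet ι) : Prop :=
  ∀ i ∈ S.idx, ∀ j ∈ S.idx, i ≠ j → S.Before i j ∨ S.Before j i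

/-- The part of general position that survives truncation, point replacement and the merging of
regions: the regions are disjoint, no two of their right (or top) sides are aligned, and a right
side can be aligned with the left side of another region only if that region lies below it, as
when it was cut off at a point region. -/
structure Generic (S : RegionSet ι) : Prop where
  disj : S.PairwiseDisjoint
  hi_fst : ∀ i ∈ S.idx, ∀ j ∈ S.idx, i ≠ j → (S.rect i).hi.1 ≠ (S.rect j).hi.1
  hi_snd : ∀ i ∈ S.idx, ∀ j ∈ S.idx, i ≠ j → (S.rect i).hi.2 ≠ (S.rect j).hi.2
  lo_fst : ∀ i ∈ S.idx, ∀ j ∈ S.idx, i ≠ j → (S.rect i).hi.1 = (S.rect j).lo.1 →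
    (S.rect j).hi.2 < (S.rect i).lo.2
  lo_snd : ∀ i ∈ S.idx, ∀ j ∈ S.idx, i ≠ j → (S.rect i).hi.2 = (S.rect j).lo.2 →
    (S.rect j).hi.1 < (S.rect i).lo.1

theorem Ordered.swap {S : RegionSet ι} (h : S.Ordered) : S.swap.Ordered := fun i hi j hj hij => by
  rw [before_swap, before_swap]
  exact (h i hi j hj hij).symm

theorem Generic.swap {S : RegionSet ι} (h : S.Generic) : S.swap.Generic where
  disj i hi j hj hij := by
    have := disjoint_carrier.1 (h.disj i hi j hj hij)
    refine disjoint_carrier.2 ?_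
    simp only [RegionSet.swap, Rect.swap, Prod.fst_swap, Prod.snd_swap]
    tauto
  hi_fst := h.hi_snd
  hi_snd := h.hi_fst
  lo_fst := h.lo_snd
  lo_snd := h.lo_fst

theorem Ordered.mono {S T : RegionSet ι} (h : S.Ordered) (hi : T.idx ⊆ S.idx)
    (hr : T.rect = S.rect) : T.Ordered := fun i hi' j hj' hij => by
  rcases h i (hi hi') j (hi hj') hij with h | h
  · exact .inl ⟨hi', hj', by simpa only [hr] using h.2.2⟩
  · exact .inr ⟨hj', hi', by simpa only [hr] using h.2.2⟩

theorem Generic.mono {S T : RegionSet ι} (h : S.Generic) (hi : T.idx ⊆ S.idx)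
    (hr : T.rect = S.rect) : T.Generic := by
  refine ⟨fun i a j b => ?_, fun i a j b => ?_, fun i a j b => ?_, fun i a j b => ?_,
    fun i a j b => ?_⟩ <;> simp only [hr]
  exacts [h.disj i (hi a) j (hi b), h.hi_fst i (hi a) j (hi b), h.hi_snd i (hi a) j (hi b),
    h.lo_fst i (hi a) j (hi b), h.lo_snd i (hi a) j (hi b)]

theorem PairwiseDisjoint.sep {S : RegionSet ι} (h : S.PairwiseDisjoint) {i j : ι}
    (hb : S.Before i j) :
    (S.rect i).hi.1 < (S.rect j).lo.1 ∨ (S.rect j).hi.2 < (S.rect i).lo.2 := by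
  have h1 := (S.rect i).le.1
  have h2 := (S.rect i).le.2
  have h3 := (S.rect j).le.1
  have h4 := (S.rect j).le.2
  have h5 := hb.2.2.1
  have h6 := hb.2.2.2.1
  rcases disjoint_carrier.1 (h i hb.1 j hb.2.1 hb.ne) with h | h | h | h
  · exact .inl h
  · linarith
  · linarith
  · exact .inr h

theorem Generic.lo_fst_ne {S : RegionSet ι} (h : S.Generic) {i j : ι} (hb : S.Before i j) :
    (S.rect i).lo.1 ≠ (S.rect j).hi.1 := fun e => by
  have h1 := h.lo_fst j hb.2.1 i hb.1 hb.ne.symm e.symm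
  have h2 := (S.rect i).le.2
  have h6 := hb.2.2.2.1
  linarith

/-! ### Arrows of the dependency graph come from overlaps -/

/-- If an earlier region overlaps `k` in `x`-direction, then some region has a vertical arrow
to `k`, namely the lowest one above `k` on a suitable vertical line. -/
theorem exists_vArrow_to {S : RegionSet ι} (hg : S.Generic) (ho : S.Ordered) {i k : ι}
    (hb : S.Before i k) (hx : (S.rect k).lo.1 < (S.rect i).hi.1) : ∃ l, S.VArrow l k := by
  classical
  have hk := (S.rect k).le.1
  have hk2 := (S.rect k).le.2
  have hb1 := hb.2.2.1
  have hsep : (S.rect k).hi.2 < (S.rect i).lo.2 :=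
    (hg.disj.sep hb).resolve_left (not_lt.2 hx.le)
  obtain ⟨x, hxi, hxi', hxk, hxk', hstrict⟩ : ∃ x, (S.rect i).lo.1 ≤ x ∧ x ≤ (S.rect i).hi.1 ∧
      (S.rect k).lo.1 ≤ x ∧ x ≤ (S.rect k).hi.1 ∧ ∀ l, S.Before l k → (S.rect l).lo.1 ≤ x →
        x ≤ (S.rect l).hi.1 → (S.rect l).lo.1 < (S.rect k).hi.1 ∧
          (S.rect k).lo.1 < (S.rect l).hi.1 := by
    rcases hk.lt_or_eq with hlt | heq
    · obtain ⟨x, h1, h2⟩ := exists_between (lt_min hx hlt)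
      rw [lt_min_iff] at h2
      exact ⟨x, hb1.trans h1.le, h2.1.le, h1.le, h2.2.le, fun l _ hl hl' =>
        ⟨hl.trans_lt h2.2, h1.trans_le hl'⟩⟩
    · refine ⟨(S.rect k).lo.1, hb1, hx.le, le_rfl, hk, fun l hl h1 h2 => ⟨?_, ?_⟩⟩
      · exact lt_of_le_of_ne (h1.trans hk) (hg.lo_fst_ne hl)
      · exact lt_of_le_of_ne h2 (heq ▸ (hg.hi_fst k hl.2.1 l hl.1 hl.ne.symm))
  obtain ⟨l, hl, hmin⟩ := Finset.exists_min_image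
    (S.idx.filter fun l => ((S.rect l).lo.1 ≤ x ∧ x ≤ (S.rect l).hi.1) ∧
      (S.rect k).hi.2 < (S.rect l).lo.2) (fun l => (S.rect l).lo.2)
    ⟨i, Finset.mem_filter.2 ⟨hb.1, ⟨hxi, hxi'⟩, hsep⟩⟩
  obtain ⟨hlS, ⟨hl1, hl2⟩, hl3⟩ := Finset.mem_filter.1 hl
  have hlk : l ≠ k := by rintro rfl; linarith
  have hlb : S.Before l k := (ho l hlS k hb.2.1 hlk).resolve_right fun h => by
    have := h.2.2.2.1
    linarith
  refine ⟨l, hlb, (hstrict l hlb hl1 hl2).1, (hstrict l hlb hl1 hl2).2, x, (S.rect l).lo.2,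
    (S.rect k).hi.2, ⟨⟨hl1, le_rfl⟩, hl2, (S.rect l).le.2⟩, ⟨⟨hxk, hk2⟩, hxk', le_rfl⟩,
    fun m hm hml hmk t ht hmem => ?_⟩
  rw [Set.uIcc_of_ge hl3.le] at ht
  obtain ⟨⟨hm1, hm2⟩, hm3, hm4⟩ := hmem
  simp only at hm1 hm2 hm3 hm4
  rcases lt_or_ge (S.rect k).hi.2 (S.rect m).lo.2 with h | h
  · have := hmin m (Finset.mem_filter.2 ⟨hm, ⟨hm1, hm3⟩, h⟩)
    have htl : t = (S.rect l).lo.2 := le_antisymm ht.2 (this.trans hm2)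
    exact absurd (hg.disj m hm l hlS hml) (Set.not_disjoint_iff.2 ⟨(x, t), ⟨⟨hm1, hm2⟩, hm3, hm4⟩,
      ⟨⟨hl1, htl.ge⟩, hl2, htl.le.trans (S.rect l).le.2⟩⟩)
  · exact absurd (hg.disj m hm k hb.2.1 hmk) (Set.not_disjoint_iff.2
      ⟨(x, (S.rect k).hi.2), ⟨⟨hm1, h⟩, hm3, ht.1.trans hm4⟩, ⟨⟨hxk, hk2⟩, hxk', le_rfl⟩⟩)

/-- If `i` overlaps a later region in `x`-direction, then `i` has a vertical arrow to some region,
namely to the highest one below `i` on a suitable vertical line. -/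
theorem exists_vArrow_from {S : RegionSet ι} (hg : S.Generic) (ho : S.Ordered) {i k : ι}
    (hb : S.Before i k) (hx : (S.rect k).lo.1 < (S.rect i).hi.1) : ∃ l, S.VArrow i l := by
  classical
  have hk := (S.rect k).le.1
  have hi2 := (S.rect i).le.2
  have hb1 := hb.2.2.1
  have hsep : (S.rect k).hi.2 < (S.rect i).lo.2 :=
    (hg.disj.sep hb).resolve_left (not_lt.2 hx.le)
  obtain ⟨x, hxi, hxi', hxk, hxk'⟩ : ∃ x, (S.rect i).lo.1 < x ∧ x < (S.rect i).hi.1 ∧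
      (S.rect k).lo.1 ≤ x ∧ x ≤ (S.rect k).hi.1 := by
    rcases hk.lt_or_eq with hlt | heq
    · obtain ⟨x, h1, h2⟩ := exists_between (lt_min hx hlt)
      rw [lt_min_iff] at h2
      exact ⟨x, hb1.trans_lt h1, h2.1, h1.le, h2.2.le⟩
    · exact ⟨(S.rect k).lo.1, lt_of_le_of_ne hb1 (heq ▸ hg.lo_fst_ne hb), hx, le_rfl, hk⟩
  obtain ⟨l, hl, hmax⟩ := Finset.exists_max_image
    (S.idx.filter fun l => ((S.rect l).lo.1 ≤ x ∧ x ≤ (S.rect l).hi.1) ∧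
      (S.rect l).hi.2 < (S.rect i).lo.2) (fun l => (S.rect l).hi.2)
    ⟨k, Finset.mem_filter.2 ⟨hb.2.1, ⟨hxk, hxk'⟩, hsep⟩⟩
  obtain ⟨hlS, ⟨hl1, hl2⟩, hl3⟩ := Finset.mem_filter.1 hl
  have hll := (S.rect l).le.2
  have hli : i ≠ l := by rintro rfl; linarith
  have hlb : S.Before i l := (ho i hb.1 l hlS hli).resolve_right fun h => by
    have := h.2.2.2.1
    linarith
  refine ⟨l, hlb, hxi.trans_le hl2, hl1.trans_lt hxi', x, (S.rect i).lo.2,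
    (S.rect l).hi.2, ⟨⟨hxi.le, le_rfl⟩, hxi'.le, hi2⟩, ⟨⟨hl1, hll⟩, hl2, le_rfl⟩,
    fun m hm hmi hml t ht hmem => ?_⟩
  rw [Set.uIcc_of_ge hl3.le] at ht
  obtain ⟨⟨hm1, hm2⟩, hm3, hm4⟩ := hmem
  simp only at hm1 hm2 hm3 hm4
  rcases lt_or_ge (S.rect m).hi.2 (S.rect i).lo.2 with h | h
  · have := hmax m (Finset.mem_filter.2 ⟨hm, ⟨hm1, hm3⟩, h⟩)
    have htl : t = (S.rect l).hi.2 := le_antisymm (hm4.trans this) ht.1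
    exact absurd (hg.disj m hm l hlS hml) (Set.not_disjoint_iff.2 ⟨(x, t), ⟨⟨hm1, hm2⟩, hm3, hm4⟩,
      ⟨⟨hl1, hll.trans htl.ge⟩, hl2, htl.le⟩⟩)
  · exact absurd (hg.disj m hm i hb.1 hmi) (Set.not_disjoint_iff.2
      ⟨(x, (S.rect i).lo.2), ⟨⟨hm1, hm2.trans ht.2⟩, hm3, h⟩, ⟨⟨hxi.le, le_rfl⟩, hxi'.le, hi2⟩⟩)

/-- A region is a source if and only if no other region overlaps it from its side of the order. -/
theorem isSource_iff {S : RegionSet ι} (hg : S.Generic) (ho : S.Ordered) {k : ι} :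
    S.IsSource k ↔ k ∈ S.idx ∧ ∀ i,
      (S.Before i k → (S.rect i).hi.1 ≤ (S.rect k).lo.1) ∧
      (S.Before k i → (S.rect i).hi.2 ≤ (S.rect k).lo.2) := by
  refine and_congr_right fun _ => ⟨fun h i => ⟨fun hb => ?_, fun hb => ?_⟩, fun h i ha => ?_⟩
  · by_contra hc
    obtain ⟨l, hl⟩ := exists_vArrow_to hg ho hb (not_le.1 hc)
    exact h l (.inl hl)
  · by_contra hc
    obtain ⟨l, hl⟩ := exists_vArrow_to hg.swap ho.swap (before_swap.2 hb) (not_le.1 hc)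
    exact h l (.inr (hArrow_iff_swap.2 hl))
  · rcases ha with ha | ha
    · exact ((h i).1 ha.1).not_gt ha.2.2.1
    · exact ((h i).2 ha.1).not_gt ha.2.2.1

/-- A region is a sink if and only if it overlaps no other region from its side of the order. -/
theorem isSink_iff {S : RegionSet ι} (hg : S.Generic) (ho : S.Ordered) {i : ι} :
    S.IsSink i ↔ i ∈ S.idx ∧ ∀ k,
      (S.Before i k → (S.rect i).hi.1 ≤ (S.rect k).lo.1) ∧
      (S.Before k i → (S.rect i).hi.2 ≤ (S.rect k).lo.2) := by
  refine and_congr_right fun _ => ⟨fun h k => ⟨fun hb => ?_, fun hb => ?_⟩, fun h k ha => ?_⟩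
  · by_contra hc
    obtain ⟨l, hl⟩ := exists_vArrow_from hg ho hb (not_le.1 hc)
    exact h l (.inl hl)
  · by_contra hc
    obtain ⟨l, hl⟩ := exists_vArrow_from hg.swap ho.swap (before_swap.2 hb) (not_le.1 hc)
    exact h l (.inr (hArrow_iff_swap.2 hl))
  · rcases ha with ha | ha
    · exact ((h k).1 ha.1).not_gt ha.2.2.1
    · exact ((h k).2 ha.1).not_gt ha.2.2.1

/-! ### Truncation -/

theorem mem_trunc_idx {S : RegionSet ι} {i : ι} :
    i ∈ S.trunc.idx ↔ i ∈ S.idx ∧ ¬ S.IsNegative i := by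
  classical
  simp [trunc]

theorem mem_trunc_idx' {S : RegionSet ι} {i : ι} :
    i ∈ S.trunc.idx ↔ i ∈ S.idx ∧ ∀ j ∈ S.idx, j ≠ i → ¬ (S.rect i).hi ≤ (S.rect j).lo := by
  rw [mem_trunc_idx]
  refine and_congr_right fun hi => ?_
  rw [isNegative_iff S hi]
  push Not
  rfl

theorem le_trunc_lo (S : RegionSet ι) (i : ι) : (S.rect i).lo ≤ (S.trunc.rect i).lo := by
  classical
  exact ⟨Finset.le_sup' (fun j => (S.rect j).lo.1) (Finset.mem_insert_self _ _),
    Finset.le_sup' (fun j => (S.rect j).lo.2) (Finset.mem_insert_self _ _)⟩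

theorem trunc_lo_fst (S : RegionSet ι) (i : ι) :
    (S.trunc.rect i).lo.1 = (S.rect i).lo.1 ∨ ∃ m ∈ S.idx, m ≠ i ∧
      (S.trunc.rect i).lo.1 = (S.rect m).lo.1 ∧ (S.rect i).hi.2 ≤ (S.rect m).lo.2 := by
  classical
  obtain ⟨m, hm, he⟩ := Finset.exists_mem_eq_sup' (Finset.insert_nonempty i
    (S.idx.filter fun j => (S.rect j).lo.1 ≤ (S.rect i).hi.1 ∧ (S.rect i).hi.2 ≤ (S.rect j).lo.2))
    (fun j => (S.rect j).lo.1)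
  by_cases hmi : m = i
  · subst hmi
    exact .inl he
  · obtain ⟨h1, h2, h3⟩ := Finset.mem_filter.1 (Finset.mem_of_mem_insert_of_ne hm hmi)
    exact .inr ⟨m, h1, hmi, he, h3⟩

theorem isNegative_swap {S : RegionSet ι} {i : ι} : S.swap.IsNegative i ↔ S.IsNegative i := by
  have key : ∀ S : RegionSet ι, S.IsNegative i → S.swap.IsNegative i := fun S h p hp => by
    obtain ⟨j, hj, hji, hle⟩ := h (fun k => (p k).swap) fun k hk =>
      ⟨⟨(hp k hk).1.2, (hp k hk).1.1⟩, ⟨(hp k hk).2.2, (hp k hk).2.1⟩⟩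
    exact ⟨j, hj, hji, hle.2, hle.1⟩
  exact ⟨key S.swap, key S⟩

theorem trunc_swap (S : RegionSet ι) : S.swap.trunc = S.trunc.swap := by
  have h : S.swap.trunc.idx = S.trunc.idx := by
    ext i
    rw [mem_trunc_idx, mem_trunc_idx, isNegative_swap]
    rfl
  change (⟨S.swap.trunc.idx, S.swap.trunc.rect⟩ : RegionSet ι) = ⟨S.trunc.idx, S.trunc.swap.rect⟩
  rw [h]
  rfl

theorem trunc_lo_snd (S : RegionSet ι) (i : ι) :
    (S.trunc.rect i).lo.2 = (S.rect i).lo.2 ∨ ∃ m ∈ S.idx, m ≠ i ∧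
      (S.trunc.rect i).lo.2 = (S.rect m).lo.2 ∧ (S.rect i).hi.1 ≤ (S.rect m).lo.1 := by
  have h := trunc_lo_fst S.swap i
  rw [trunc_swap] at h
  exact h

/-- The bottom left vertex of a truncated region lies on the guaranteed boundary, so it is dominated
by the bottom left vertex of a region. -/
theorem exists_trunc_lo_le (S : RegionSet ι) {i : ι} (hi : i ∈ S.idx) :
    ∃ m ∈ S.idx, (S.trunc.rect i).lo ≤ (S.rect m).lo := by
  have hle := (S.trunc.rect i).le
  rcases trunc_lo_fst S i with h1 | ⟨m, hm, -, h1, h1'⟩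
  · rcases trunc_lo_snd S i with h2 | ⟨m, hm, -, h2, h2'⟩
    · exact ⟨i, hi, h1.le, h2.le⟩
    · exact ⟨m, hm, hle.1.trans h2', h2.le⟩
  · exact ⟨m, hm, h1.le, hle.2.trans h1'⟩

theorem trunc_carrier_subset (S : RegionSet ι) (i : ι) :
    (S.trunc.rect i).carrier ⊆ (S.rect i).carrier :=
  Set.Icc_subset_Icc (le_trunc_lo S i) le_rfl

theorem not_belowBoundary_of_mem_trunc {S : RegionSet ι} (hS : S.PairwiseDisjoint) {i : ι}
    (hi : i ∈ S.trunc.idx) {z : ℝ × ℝ} (hz : z ∈ (S.trunc.rect i).carrier) :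
    ¬ S.BelowBoundary z := by
  obtain ⟨hi, hn⟩ := mem_trunc_idx.1 hi
  have h : z ∈ (S.cut i).carrier := hz
  rw [carrier_cut S hS hi hn] at h
  exact h.2

/-- The bottom left vertices of truncated regions lie on a staircase, so they are totally ordered
from top left to bottom right. -/
theorem ordered_trunc {S : RegionSet ι} (hS : S.PairwiseDisjoint) : S.trunc.Ordered := by
  have hlo : ∀ i, (S.trunc.rect i).lo ∈ (S.trunc.rect i).carrier := fun i =>
    ⟨le_rfl, (S.trunc.rect i).le⟩
  have key : ∀ i ∈ S.trunc.idx, ∀ j ∈ S.trunc.idx,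
      (S.trunc.rect i).lo.1 < (S.trunc.rect j).lo.1 →
        (S.trunc.rect j).lo.2 ≤ (S.trunc.rect i).lo.2 := fun i hi j hj h => by
    by_contra! hc
    obtain ⟨m, hm, hle⟩ := exists_trunc_lo_le S (mem_trunc_idx.1 hj).1
    exact not_belowBoundary_of_mem_trunc hS hi (hlo i)
      ⟨m, hm, h.trans_le hle.1, hc.trans_le hle.2⟩
  intro i hi j hj hij
  have hne : (S.trunc.rect i).lo ≠ (S.trunc.rect j).lo := fun e =>
    Set.disjoint_left.1 (hS i (mem_trunc_idx.1 hi).1 j (mem_trunc_idx.1 hj).1 hij)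
      (trunc_carrier_subset S i (hlo i)) (trunc_carrier_subset S j (e ▸ hlo j))
  rcases lt_trichotomy (S.trunc.rect i).lo.1 (S.trunc.rect j).lo.1 with h | h | h
  · exact .inl ⟨hi, hj, h.le, key i hi j hj h, hne⟩
  · rcases le_total (S.trunc.rect i).lo.2 (S.trunc.rect j).lo.2 with h' | h'
    · exact .inr ⟨hj, hi, h.ge, h', hne.symm⟩
    · exact .inl ⟨hi, hj, h.le, h', hne⟩
  · exact .inr ⟨hj, hi, h.le, key j hj i hi h, hne.symm⟩

theorem trunc_lo_fst_generic {S : RegionSet ι} (hS : S.Generic) {i j : ι} (hi : i ∈ S.idx)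
    (hj : j ∈ S.idx) (hij : i ≠ j) (h : (S.rect i).hi.1 = (S.trunc.rect j).lo.1) :
    (S.rect j).hi.2 < (S.trunc.rect i).lo.2 := by
  have hi' := (le_trunc_lo S i).2
  have hj' := (le_trunc_lo S j).1
  have hji := (S.rect j).le.1
  have hjt : (S.trunc.rect j).lo.1 ≤ (S.rect j).hi.1 := (S.trunc.rect j).le.1
  rcases trunc_lo_fst S j with e | ⟨m, hm, hmj, e, hle⟩
  · exact (hS.lo_fst i hi j hj hij (h.trans e)).trans_le hi'
  · by_cases hmi : i = m
    · subst hmi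
      refine lt_of_le_of_ne (hle.trans hi') fun e' => ?_
      have e2 : (S.rect j).hi.2 = (S.rect i).lo.2 := le_antisymm hle (e' ▸ hi')
      have := hS.lo_snd j hj i hi hmj.symm e2
      have := (S.rect i).le.1
      linarith
    · have := hS.lo_fst i hi m hm hmi (h.trans e)
      have := (S.rect m).le.2
      linarith

theorem generic_trunc {S : RegionSet ι} (hS : S.Generic) : S.trunc.Generic where
  disj i hi j hj hij := (hS.disj i (mem_trunc_idx.1 hi).1 j (mem_trunc_idx.1 hj).1 hij).mono
    (trunc_carrier_subset S i) (trunc_carrier_subset S j)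
  hi_fst i hi j hj := hS.hi_fst i (mem_trunc_idx.1 hi).1 j (mem_trunc_idx.1 hj).1
  hi_snd i hi j hj := hS.hi_snd i (mem_trunc_idx.1 hi).1 j (mem_trunc_idx.1 hj).1
  lo_fst i hi j hj hij h :=
    trunc_lo_fst_generic hS (mem_trunc_idx.1 hi).1 (mem_trunc_idx.1 hj).1 hij h
  lo_snd i hi j hj hij h := by
    have := trunc_lo_fst_generic hS.swap (i := i) (j := j) (mem_trunc_idx.1 hi).1
      (mem_trunc_idx.1 hj).1 hij
    rw [trunc_swap] at this
    exact this h

/-! ### General position -/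

theorem Respects.swap {S : RegionSet ι} {P : ι → ℝ × ℝ} (h : S.Respects P) :
    S.swap.Respects (fun i => (P i).swap) := fun i hi =>
  ⟨⟨(h i hi).1.2, (h i hi).1.1⟩, ⟨(h i hi).2.2, (h i hi).2.1⟩⟩

theorem GeneralPosition.swap {S : RegionSet ι} {P : ι → ℝ × ℝ} (h : S.GeneralPosition P) :
    S.swap.GeneralPosition (fun i => (P i).swap) where
  shape i hi := (h.shape i hi).imp (fun e => congrArg Prod.swap e) fun e => ⟨e.2, e.1⟩
  own i hi := (h.own i hi).imp (fun e => congrArg Prod.swap e)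
    fun e => ⟨e.2.2.1, e.2.2.2, e.1, e.2.1⟩
  xcoord := h.ycoord
  ycoord := h.xcoord

theorem GeneralPosition.fst_ne {S : RegionSet ι} {P : ι → ℝ × ℝ} (h : S.GeneralPosition P)
    {i j : ι} (hi : i ∈ S.idx) (hj : j ∈ S.idx) (hij : i ≠ j) {x y : ℝ}
    (hx : x = (S.rect i).lo.1 ∨ x = (S.rect i).hi.1 ∨ x = (P i).1)
    (hy : y = (S.rect j).lo.1 ∨ y = (S.rect j).hi.1 ∨ y = (P j).1) : x ≠ y := by
  rintro rfl
  exact Set.disjoint_left.1 (h.xcoord i hi j hj hij) (by simpa using hx) (by simpa using hy)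

theorem GeneralPosition.snd_ne {S : RegionSet ι} {P : ι → ℝ × ℝ} (h : S.GeneralPosition P)
    {i j : ι} (hi : i ∈ S.idx) (hj : j ∈ S.idx) (hij : i ≠ j) {x y : ℝ}
    (hx : x = (S.rect i).lo.2 ∨ x = (S.rect i).hi.2 ∨ x = (P i).2)
    (hy : y = (S.rect j).lo.2 ∨ y = (S.rect j).hi.2 ∨ y = (P j).2) : x ≠ y :=
  h.swap.fst_ne hi hj hij hx hy

theorem GeneralPosition.generic {S : RegionSet ι} {P : ι → ℝ × ℝ} (h : S.GeneralPosition P)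
    (hd : S.PairwiseDisjoint) : S.Generic where
  disj := hd
  hi_fst _ hi _ hj hij := h.fst_ne hi hj hij (.inr (.inl rfl)) (.inr (.inl rfl))
  hi_snd _ hi _ hj hij := h.snd_ne hi hj hij (.inr (.inl rfl)) (.inr (.inl rfl))
  lo_fst _ hi _ hj hij e := absurd e (h.fst_ne hi hj hij (.inr (.inl rfl)) (.inl rfl))
  lo_snd _ hi _ hj hij e := absurd e (h.snd_ne hi hj hij (.inr (.inl rfl)) (.inl rfl))

variable {κ : Type*}

/-! ### Revealing points -/

open scoped Classical in
/-- The family `K` after the points `q B` of the regions `B ∈ D` have been revealed. Only the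
regions that satisfy `sg` (the ones that are not compound) can be replaced by a point. -/
noncomputable def reveal (K : RegionSet κ) (q : κ → ℝ × ℝ) (sg : κ → Prop) (D : Finset κ) :
    RegionSet κ where
  idx := K.idx
  rect B := if B ∈ D ∧ sg B then Rect.point (q B) else K.rect B

/-- What the search uses about the canonical set `K` with points `q`: genericity of `K` and of the
points that can be revealed, and a set `N` of regions with points on the Pareto front that contains
everything relevant for dominating or cutting off a region of `K`. -/
structure SearchFamily (K : RegionSet κ) (q : κ → ℝ × ℝ) (sg : κ → Prop) (N : Set κ) : Prop where
  gen : K.Generic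
  ord : K.Ordered
  mem_idx : ∀ e ∈ N, e ∈ K.idx
  single : ∀ e ∈ N, sg e
  mem : ∀ e ∈ N, q e ∈ (K.rect e).carrier
  notMem : ∀ j ∈ K.idx, sg j → ∀ m ∈ K.idx, m ≠ j → q j ∉ (K.rect m).carrier
  fst_ne_hi : ∀ j ∈ K.idx, sg j → ∀ m ∈ K.idx, m ≠ j → (q j).1 ≠ (K.rect m).hi.1
  snd_ne_hi : ∀ j ∈ K.idx, sg j → ∀ m ∈ K.idx, m ≠ j → (q j).2 ≠ (K.rect m).hi.2
  fst_lo : ∀ j ∈ K.idx, sg j → ∀ m ∈ K.idx, m ≠ j → (q j).1 = (K.rect m).lo.1 →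
    (K.rect m).hi.2 < (q j).2
  snd_lo : ∀ j ∈ K.idx, sg j → ∀ m ∈ K.idx, m ≠ j → (q j).2 = (K.rect m).lo.2 →
    (K.rect m).hi.1 < (q j).1
  fst_ne : ∀ j ∈ K.idx, sg j → ∀ m ∈ K.idx, sg m → m ≠ j → (q j).1 ≠ (q m).1
  snd_ne : ∀ j ∈ K.idx, sg j → ∀ m ∈ K.idx, sg m → m ≠ j → (q j).2 ≠ (q m).2
  not_le_lo : ∀ e ∈ N, ∀ m ∈ K.idx, m ≠ e → ¬ q e ≤ (K.rect m).lo
  not_le_pt : ∀ e ∈ N, ∀ m ∈ K.idx, sg m → m ≠ e → ¬ q e ≤ q m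
  lo_cut_fst : ∀ c ∈ K.idx, ∀ m ∈ K.idx, (K.rect c).lo.1 < (K.rect m).lo.1 →
    (K.rect c).hi.2 ≤ (K.rect m).lo.2 →
    ∃ e ∈ N, e ≠ c ∧ (K.rect m).lo ≤ q e ∧ (K.rect m).lo.1 < (q e).1
  lo_cut_snd : ∀ c ∈ K.idx, ∀ m ∈ K.idx, (K.rect c).lo.2 < (K.rect m).lo.2 →
    (K.rect c).hi.1 ≤ (K.rect m).lo.1 →
    ∃ e ∈ N, e ≠ c ∧ (K.rect m).lo ≤ q e ∧ (K.rect m).lo.2 < (q e).2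
  pt_cut_fst : ∀ c ∈ K.idx, ∀ m ∈ K.idx, sg m → (K.rect c).lo.1 < (q m).1 →
    (K.rect c).hi.2 ≤ (q m).2 →
    ∃ e ∈ N, e ≠ c ∧ q m ≤ q e ∧ ((q m).1 < (q e).1 ∨ e = m)
  pt_cut_snd : ∀ c ∈ K.idx, ∀ m ∈ K.idx, sg m → (K.rect c).lo.2 < (q m).2 →
    (K.rect c).hi.1 ≤ (q m).1 →
    ∃ e ∈ N, e ≠ c ∧ q m ≤ q e ∧ ((q m).2 < (q e).2 ∨ e = m)

theorem SearchFamily.swap {K : RegionSet κ} {q : κ → ℝ × ℝ} {sg : κ → Prop} {N : Set κ}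
    (h : SearchFamily K q sg N) : SearchFamily K.swap (fun B => (q B).swap) sg N where
  gen := h.gen.swap
  ord := h.ord.swap
  mem_idx := h.mem_idx
  single := h.single
  mem e he := mem_carrier_swap.2 (h.mem e he)
  notMem j hj sj m hm hmj hc := h.notMem j hj sj m hm hmj (mem_carrier_swap.1 hc)
  fst_ne_hi := h.snd_ne_hi
  snd_ne_hi := h.fst_ne_hi
  fst_lo := h.snd_lo
  snd_lo := h.fst_lo
  fst_ne := h.snd_ne
  snd_ne := h.fst_ne
  not_le_lo e he m hm hme hc := h.not_le_lo e he m hm hme ⟨hc.2, hc.1⟩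
  not_le_pt e he m hm sm hme hc := h.not_le_pt e he m hm sm hme ⟨hc.2, hc.1⟩
  lo_cut_fst c hc m hm h1 h2 := by
    obtain ⟨e, he, hec, h3, h4⟩ := h.lo_cut_snd c hc m hm h1 h2
    exact ⟨e, he, hec, ⟨h3.2, h3.1⟩, h4⟩
  lo_cut_snd c hc m hm h1 h2 := by
    obtain ⟨e, he, hec, h3, h4⟩ := h.lo_cut_fst c hc m hm h1 h2
    exact ⟨e, he, hec, ⟨h3.2, h3.1⟩, h4⟩
  pt_cut_fst c hc m hm sm h1 h2 := by
    obtain ⟨e, he, hec, h3, h4⟩ := h.pt_cut_snd c hc m hm sm h1 h2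
    exact ⟨e, he, hec, ⟨h3.2, h3.1⟩, h4⟩
  pt_cut_snd c hc m hm sm h1 h2 := by
    obtain ⟨e, he, hec, h3, h4⟩ := h.pt_cut_fst c hc m hm sm h1 h2
    exact ⟨e, he, hec, ⟨h3.2, h3.1⟩, h4⟩

section Reveal

variable {K : RegionSet κ} {q : κ → ℝ × ℝ} {sg : κ → Prop} {N : Set κ} {D : Finset κ}

theorem reveal_rect_of_mem {B : κ} (hB : B ∈ D) (hs : sg B) :
    (reveal K q sg D).rect B = Rect.point (q B) := if_pos ⟨hB, hs⟩

theorem reveal_rect_of_not {B : κ} (hB : ¬ (B ∈ D ∧ sg B)) :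
    (reveal K q sg D).rect B = K.rect B := if_neg hB

theorem reveal_swap :
    reveal K.swap (fun B => (q B).swap) sg D = (reveal K q sg D).swap := by
  simp only [reveal, RegionSet.swap, mk.injEq, true_and]
  funext B
  split_ifs <;> rfl

theorem SearchFamily.reveal_disjoint (h : SearchFamily K q sg N) :
    (reveal K q sg D).PairwiseDisjoint := fun i hi j hj hij => by
  have key : ∀ B, sg B → B ∈ K.idx → ∀ m ∈ K.idx, m ≠ B →
      Disjoint (Rect.point (q B)).carrier (K.rect m).carrier := fun B sB hB m hm hmB => by
    simpa [Rect.point, Rect.carrier] using h.notMem B hB sB m hm hmB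
  by_cases ci : i ∈ D ∧ sg i <;> by_cases cj : j ∈ D ∧ sg j
  · rw [reveal_rect_of_mem ci.1 ci.2, reveal_rect_of_mem cj.1 cj.2]
    have := h.fst_ne i hi ci.2 j hj cj.2 hij.symm
    simp only [Rect.point, Rect.carrier, Set.Icc_self, Set.disjoint_singleton]
    exact fun e => this (congrArg Prod.fst e)
  · rw [reveal_rect_of_mem ci.1 ci.2, reveal_rect_of_not cj]
    exact key i ci.2 hi j hj hij.symm
  · rw [reveal_rect_of_mem cj.1 cj.2, reveal_rect_of_not ci]
    exact (key j cj.2 hj i hi hij).symm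
  · rw [reveal_rect_of_not ci, reveal_rect_of_not cj]
    exact h.gen.disj i hi j hj hij

theorem SearchFamily.reveal_hi_fst (h : SearchFamily K q sg N) {i j : κ} (hi : i ∈ K.idx)
    (hj : j ∈ K.idx) (hij : i ≠ j) :
    ((reveal K q sg D).rect i).hi.1 ≠ ((reveal K q sg D).rect j).hi.1 := by
  by_cases ci : i ∈ D ∧ sg i <;> by_cases cj : j ∈ D ∧ sg j
  · rw [reveal_rect_of_mem ci.1 ci.2, reveal_rect_of_mem cj.1 cj.2]
    exact h.fst_ne i hi ci.2 j hj cj.2 hij.symm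
  · rw [reveal_rect_of_mem ci.1 ci.2, reveal_rect_of_not cj]
    exact h.fst_ne_hi i hi ci.2 j hj hij.symm
  · rw [reveal_rect_of_mem cj.1 cj.2, reveal_rect_of_not ci]
    exact (h.fst_ne_hi j hj cj.2 i hi hij).symm
  · rw [reveal_rect_of_not ci, reveal_rect_of_not cj]
    exact h.gen.hi_fst i hi j hj hij

theorem SearchFamily.reveal_lo_fst (h : SearchFamily K q sg N) {i j : κ} (hi : i ∈ K.idx)
    (hj : j ∈ K.idx) (hij : i ≠ j)
    (e : ((reveal K q sg D).rect i).hi.1 = ((reveal K q sg D).rect j).lo.1) :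
    ((reveal K q sg D).rect j).hi.2 < ((reveal K q sg D).rect i).lo.2 := by
  by_cases ci : i ∈ D ∧ sg i <;> by_cases cj : j ∈ D ∧ sg j
  · rw [reveal_rect_of_mem ci.1 ci.2, reveal_rect_of_mem cj.1 cj.2] at e
    exact absurd e (h.fst_ne i hi ci.2 j hj cj.2 hij.symm)
  · rw [reveal_rect_of_mem ci.1 ci.2, reveal_rect_of_not cj] at e ⊢
    exact h.fst_lo i hi ci.2 j hj hij.symm e
  · rw [reveal_rect_of_mem cj.1 cj.2, reveal_rect_of_not ci] at e
    exact absurd e.symm (h.fst_ne_hi j hj cj.2 i hi hij)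
  · rw [reveal_rect_of_not ci, reveal_rect_of_not cj] at e ⊢
    exact h.gen.lo_fst i hi j hj hij e

theorem SearchFamily.generic_reveal (h : SearchFamily K q sg N) :
    (reveal K q sg D).Generic where
  disj := h.reveal_disjoint
  hi_fst _ hi _ hj hij := h.reveal_hi_fst hi hj hij
  hi_snd i hi j hj hij := by
    have := h.swap.reveal_hi_fst (D := D) hi hj hij
    rw [reveal_swap] at this
    exact this
  lo_fst _ hi _ hj hij e := h.reveal_lo_fst hi hj hij e
  lo_snd i hi j hj hij := by
    have := h.swap.reveal_lo_fst (D := D) hi hj hij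
    rw [reveal_swap] at this
    exact this

/-! ### The invariant of the search -/

/-- No point of the front set `N`, except possibly that of `c` itself, dominates the whole
region `c`. -/
def Undominated (K : RegionSet κ) (q : κ → ℝ × ℝ) (N : Set κ) (c : κ) : Prop :=
  ∀ e ∈ N, e ≠ c → ¬ (K.rect c).hi ≤ q e

/-- Every earlier point that reaches over the region `c` is in the shadow of an already revealed
point, which cuts off `c` at least as far to the right. -/
def Shielded (K : RegionSet κ) (q : κ → ℝ × ℝ) (N : Set κ) (D : Finset κ) (c : κ) : Prop :=
  ∀ j ∈ N, K.Before j c → (K.rect c).lo.1 < (q j).1 →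
    ∃ e ∈ N, e ∈ D ∧ e ≠ c ∧ (q j).1 ≤ (q e).1 ∧ (K.rect c).hi.2 ≤ (q e).2

/-- The invariant satisfied by all regions that the algorithm has selected for processing. -/
structure Settled (K : RegionSet κ) (q : κ → ℝ × ℝ) (N : Set κ) (D : Finset κ) (c : κ) :
    Prop where
  undominated : K.Undominated q N c
  left : K.Shielded q N D c
  right : K.swap.Shielded (fun B => (q B).swap) N D c

theorem undominated_swap {c : κ} :
    K.swap.Undominated (fun B => (q B).swap) N c ↔ K.Undominated q N c :=
  ⟨fun h e he hec hle => h e he hec ⟨hle.2, hle.1⟩,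
    fun h e he hec hle => h e he hec ⟨hle.2, hle.1⟩⟩

theorem Settled.swap {c : κ} (h : Settled K q N D c) :
    Settled K.swap (fun B => (q B).swap) N D c :=
  ⟨undominated_swap.2 h.undominated, h.right, h.left⟩

theorem Settled.mono {c : κ} {D' : Finset κ} (h : Settled K q N D c) (hD : D ⊆ D') :
    Settled K q N D' c := by
  refine ⟨h.undominated, fun j hj hb hlt => ?_, fun j hj hb hlt => ?_⟩
  · obtain ⟨e, he, heD, h'⟩ := h.left j hj hb hlt
    exact ⟨e, he, hD heD, h'⟩
  · obtain ⟨e, he, heD, h'⟩ := h.right j hj hb hlt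
    exact ⟨e, he, hD heD, h'⟩

/-- The sources of the initial dependency graph satisfy the invariant. -/
theorem SearchFamily.settled_of_isSource (h : SearchFamily K q sg N) {c : κ}
    (hc : K.IsSource c) : Settled K q N D c := by
  rw [isSource_iff h.gen h.ord] at hc
  obtain ⟨hcK, hc⟩ := hc
  have hlo := (K.rect c).le
  refine ⟨fun e he hec hle => ?_, fun j hj hb hlt => ?_, fun j hj hb hlt => ?_⟩
  · have hm := h.mem e he
    rcases h.ord e (h.mem_idx e he) c hcK hec with hb | hb
    · have h1 := (hc e).1 hb
      have h2 := h.fst_ne_hi e (h.mem_idx e he) (h.single e he) c hcK hec.symm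
      exact h2 (le_antisymm ((hm.2.1.trans h1).trans hlo.1) hle.1)
    · have h1 := (hc e).2 hb
      have h2 := h.snd_ne_hi e (h.mem_idx e he) (h.single e he) c hcK hec.symm
      exact h2 (le_antisymm ((hm.2.2.trans h1).trans hlo.2) hle.2)
  · exact absurd (((h.mem j hj).2.1).trans ((hc j).1 hb)) (not_le.2 hlt)
  · exact absurd (((h.mem j hj).2.2).trans ((hc j).2 (before_swap.1 hb))) (not_le.2 hlt)

/-- The situation when `c` becomes a source in the interval between the regions `a` and `b`, which
have just been processed: `T` is the part of the current truncated set in this interval. -/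
structure ChildSituation (K : RegionSet κ) (q : κ → ℝ × ℝ) (sg : κ → Prop) (N : Set κ)
    (D : Finset κ) (T : RegionSet κ) (a b c : κ) : Prop where
  fam : SearchFamily K q sg N
  settled_left : Settled K q N D a
  settled_right : Settled K q N D b
  left_mem : a ∈ D
  right_mem : b ∈ D
  before_left : K.Before a c
  before_right : K.Before c b
  notMem : c ∉ D
  subset : T.idx ⊆ (reveal K q sg D).trunc.idx
  rect : T.rect = (reveal K q sg D).trunc.rect
  between : ∀ B ∈ (reveal K q sg D).trunc.idx, K.Before a B → K.Before B b → B ∈ T.idx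
  isSource : T.IsSource c

namespace ChildSituation

variable {T : RegionSet κ} {a b c : κ}

theorem swap (h : ChildSituation K q sg N D T a b c) :
    ChildSituation K.swap (fun B => (q B).swap) sg N D T.swap b a c where
  fam := h.fam.swap
  settled_left := h.settled_right.swap
  settled_right := h.settled_left.swap
  left_mem := h.right_mem
  right_mem := h.left_mem
  before_left := before_swap.2 h.before_right
  before_right := before_swap.2 h.before_left
  notMem := h.notMem
  subset := by rw [reveal_swap, trunc_swap]; exact h.subset
  rect := by
    rw [reveal_swap, trunc_swap]
    simp only [RegionSet.swap, h.rect]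
  between B hB hb hb' := by
    rw [reveal_swap, trunc_swap] at hB
    exact h.between B hB (before_swap.1 hb') (before_swap.1 hb)
  isSource := isSource_swap.2 h.isSource

theorem generic (h : ChildSituation K q sg N D T a b c) : T.Generic :=
  (generic_trunc h.fam.generic_reveal).mono h.subset h.rect

theorem ordered (h : ChildSituation K q sg N D T a b c) : T.Ordered :=
  (ordered_trunc h.fam.reveal_disjoint).mono h.subset h.rect

theorem rect_hi (h : ChildSituation K q sg N D T a b c) {B : κ} (hB : B ∉ D) :
    (T.rect B).hi = (K.rect B).hi := by
  rw [h.rect, ← reveal_rect_of_not (K := K) (q := q) (sg := sg) (D := D) fun hc => hB hc.1]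
  rfl

theorem lo_le (h : ChildSituation K q sg N D T a b c) {B : κ} (hB : B ∉ D) :
    (K.rect B).lo ≤ (T.rect B).lo := by
  rw [h.rect, ← reveal_rect_of_not (K := K) (q := q) (sg := sg) (D := D) fun hc => hB hc.1]
  exact le_trunc_lo _ _

/-- A region whose point is on the Pareto front is never negative. -/
theorem mem_idx_of_mem (h : ChildSituation K q sg N D T a b c) {e : κ} (he : e ∈ N)
    (heD : e ∉ D) (hae : K.Before a e) (heb : K.Before e b) : e ∈ T.idx := by
  refine h.between e (mem_trunc_idx'.2 ⟨h.fam.mem_idx e he, fun m hm hme hle => ?_⟩) hae heb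
  rw [reveal_rect_of_not fun hc => heD hc.1] at hle
  have hq := (h.fam.mem e he).2.trans hle
  by_cases cm : m ∈ D ∧ sg m
  · rw [reveal_rect_of_mem cm.1 cm.2] at hq
    exact h.fam.not_le_pt e he m hm cm.2 hme hq
  · rw [reveal_rect_of_not cm] at hq
    exact h.fam.not_le_lo e he m hm hme hq

/-- A point that is not revealed, and belongs to an earlier region of the interval, does not reach
beyond the left side of the source `c`. -/
theorem fst_le_lo (h : ChildSituation K q sg N D T a b c) {e : κ} (he : e ∈ N)
    (heD : e ∉ D) (hae : K.Before a e) (hec : K.Before e c)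
    (hlt : (K.rect c).lo.1 < (q e).1) : (q e).1 ≤ (T.rect c).lo.1 := by
  have hT := h.mem_idx_of_mem he heD hae (hec.trans h.before_right)
  have hc := h.isSource
  rw [isSource_iff h.generic h.ordered] at hc
  have hqe := (h.fam.mem e he).2.1
  have hsep : (K.rect c).hi.2 < (K.rect e).lo.2 :=
    (h.fam.gen.disj.sep hec).resolve_left (by linarith)
  have hb : T.Before e c := (h.ordered e hT c hc.1 hec.ne).resolve_right fun hb => by
    have h1 := hb.2.2.2.1
    have h2 := (h.lo_le heD).2
    have h3 := (T.rect c).le.2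
    rw [h.rect_hi h.notMem] at h3
    linarith
  have := (hc.2 e).1 hb
  rw [h.rect_hi heD] at this
  exact hqe.trans this

theorem not_hi_le_of_mem (h : ChildSituation K q sg N D T a b c) {e : κ} (he : e ∈ N)
    (heD : e ∈ D) : ¬ (K.rect c).hi ≤ q e := fun hle => by
  have hc := mem_trunc_idx'.1 (h.subset h.isSource.1)
  refine hc.2 e (h.fam.mem_idx e he) (fun e' => h.notMem (e' ▸ heD)) ?_
  rw [reveal_rect_of_not fun hc => h.notMem hc.1, reveal_rect_of_mem heD (h.fam.single e he)]
  exact hle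

/-- A point from before the interval that reaches over `c` is in the shadow of a revealed
point that cuts off `c`, since it reaches over `a` as well. -/
theorem exists_shield (h : ChildSituation K q sg N D T a b c) {e : κ} (he : e ∈ N)
    (hea : K.Before e a) (hlt : (K.rect c).lo.1 < (q e).1) :
    ∃ e' ∈ N, e' ∈ D ∧ (q e).1 ≤ (q e').1 ∧ (K.rect c).hi.2 ≤ (q e').2 := by
  have hac := h.before_left.2.2.1
  obtain ⟨e', he', he'D, -, h1, h2⟩ := h.settled_left.left e he hea (hac.trans_lt hlt)
  have hm := h.fam.mem e he
  have hsep : (K.rect a).hi.2 < (K.rect e).lo.2 :=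
    (h.fam.gen.disj.sep hea).resolve_left (by linarith [hm.2.1])
  have hqa : (q e).1 < (K.rect a).hi.1 := by
    by_contra! hc
    exact h.settled_left.undominated e he hea.ne ⟨hc, hsep.le.trans hm.1.2⟩
  have hsep' : (K.rect c).hi.2 < (K.rect a).lo.2 :=
    (h.fam.gen.disj.sep h.before_left).resolve_left (by linarith)
  exact ⟨e', he', he'D, h1, (hsep'.le.trans (K.rect a).le.2).trans h2⟩

theorem not_hi_le_of_before (h : ChildSituation K q sg N D T a b c) {e : κ} (he : e ∈ N)
    (hec : K.Before e c) : ¬ (K.rect c).hi ≤ q e := fun hle => by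
  have heD : e ∉ D := fun heD => h.not_hi_le_of_mem he heD hle
  have heK := h.fam.mem_idx e he
  have hlt : (K.rect c).hi.1 < (q e).1 := lt_of_le_of_ne hle.1
    (h.fam.fst_ne_hi e heK (h.fam.single e he) c hec.2.1 hec.ne.symm).symm
  have hlo := (K.rect c).le.1
  rcases h.fam.ord a h.before_left.1 e heK (fun e' => heD (e' ▸ h.left_mem)) with hae | hea
  · have h1 := h.fst_le_lo he heD hae hec (hlo.trans_lt hlt)
    have h2 := (T.rect c).le.1
    rw [h.rect_hi h.notMem] at h2
    linarith
  · obtain ⟨e', he', he'D, h1, h2⟩ := h.exists_shield he hea (hlo.trans_lt hlt)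
    exact h.not_hi_le_of_mem he' he'D ⟨hle.1.trans h1, h2⟩

theorem undominated (h : ChildSituation K q sg N D T a b c) : K.Undominated q N c :=
  fun e he hec hle => by
    rcases h.fam.ord e (h.fam.mem_idx e he) c h.before_left.2.1 hec with hb | hb
    · exact h.not_hi_le_of_before he hb hle
    · exact h.swap.not_hi_le_of_before he (before_swap.2 hb) ⟨hle.2, hle.1⟩

theorem shielded (h : ChildSituation K q sg N D T a b c) : K.Shielded q N D c :=
  fun j hj hjc hlt => by
    have hcK := hjc.2.1
    have hne : ∀ e ∈ D, e ≠ c := fun e he hec => h.notMem (hec ▸ he)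
    have hsep : ∀ e ∈ N, K.Before e c → (K.rect c).lo.1 < (q e).1 →
        (K.rect c).hi.2 < (q e).2 := fun e he hec hlt =>
      ((h.fam.gen.disj.sep hec).resolve_left
        (by linarith [(h.fam.mem e he).2.1])).trans_le (h.fam.mem e he).1.2
    by_cases hjD : j ∈ D
    · exact ⟨j, hj, hjD, hne j hjD, le_rfl, (hsep j hj hjc hlt).le⟩
    rcases h.fam.ord a h.before_left.1 j hjc.1 (fun e' => hjD (e' ▸ h.left_mem)) with haj | hja
    swap
    · obtain ⟨e, he, heD, h1, h2⟩ := h.exists_shield hj hja hlt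
      exact ⟨e, he, heD, hne e heD, h1, h2⟩
    -- The point of `j` is unrevealed and in the interval, so `c` must have been cut off.
    have hjl := h.fst_le_lo hj hjD haj hjc hlt
    obtain ⟨e, he, hec, h1, h2, h3⟩ : ∃ e ∈ N, e ≠ c ∧ (T.rect c).lo.1 ≤ (q e).1 ∧
        (K.rect c).hi.2 ≤ (q e).2 ∧ ((T.rect c).lo.1 < (q e).1 ∨ e ∈ D) := by
      have hrc : (reveal K q sg D).rect c = K.rect c :=
        reveal_rect_of_not fun hc => h.notMem hc.1
      rw [h.rect] at hjl ⊢
      rcases trunc_lo_fst (reveal K q sg D) c with e1 | ⟨m, hm, -, e1, hle⟩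
      · rw [e1, hrc] at hjl
        exact absurd hjl (not_le.2 hlt)
      · rw [hrc] at hle
        rw [e1] at hjl ⊢
        by_cases cm : m ∈ D ∧ sg m
        · rw [reveal_rect_of_mem cm.1 cm.2] at hjl hle ⊢
          obtain ⟨e, he, hec, hqe, hor⟩ :=
            h.fam.pt_cut_fst c hcK m hm cm.2 (hlt.trans_le hjl) hle
          exact ⟨e, he, hec, hqe.1, hle.trans hqe.2, hor.imp_right (by rintro rfl; exact cm.1)⟩
        · rw [reveal_rect_of_not cm] at hjl hle ⊢
          obtain ⟨e, he, hec, hqe, hor⟩ := h.fam.lo_cut_fst c hcK m hm (hlt.trans_le hjl) hle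
          exact ⟨e, he, hec, hqe.1, hle.trans hqe.2, .inl hor⟩
    by_cases heD : e ∈ D
    · exact ⟨e, he, heD, hec, hjl.trans h1, h2⟩
    have hlt' := h3.resolve_right heD
    have hce : (K.rect c).lo.1 < (q e).1 := hlt.trans_le (hjl.trans h1)
    have hm := h.fam.mem e he
    have heK := h.fam.mem_idx e he
    rcases h.fam.ord e heK c hcK hec with hb | hb
    · rcases h.fam.ord a h.before_left.1 e heK (fun e' => heD (e' ▸ h.left_mem)) with hae | hea
      · exact absurd (h.fst_le_lo he heD hae hb hce) (not_le.2 hlt')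
      · obtain ⟨e', he', he'D, h4, h5⟩ := h.exists_shield he hea hce
        exact ⟨e', he', he'D, hne e' he'D, (hjl.trans h1).trans h4, h5⟩
    · -- The point of a later region at that height would dominate all of `c`.
      have := (h.fam.gen.disj.sep hb).resolve_right
        (by linarith [hm.2.2, (K.rect c).le.2])
      exact absurd ⟨this.le.trans hm.1.1, h2⟩ (h.undominated e he hec)

theorem settled (h : ChildSituation K q sg N D T a b c) : Settled K q N D c :=
  ⟨h.undominated, h.shielded, h.swap.shielded⟩

end ChildSituation

end Reveal

/-! ### The canonical set -/

/-- The position of a region in the order from top left to bottom right. -/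
def pos (S : RegionSet ι) (i : ι) : ℝ := (S.rect i).lo.1 - (S.rect i).lo.2

theorem Before.pos_lt {S : RegionSet ι} {i j : ι} (h : S.Before i j) : S.pos i < S.pos j := by
  obtain ⟨-, -, h1, h2, h3⟩ := h
  unfold pos
  by_contra! hc
  exact h3 (Prod.ext (by linarith) (by linarith))

theorem Ordered.before_iff {S : RegionSet ι} (h : S.Ordered) {i j : ι} (hi : i ∈ S.idx)
    (hj : j ∈ S.idx) : S.Before i j ↔ S.pos i < S.pos j := by
  refine ⟨Before.pos_lt, fun hlt => ?_⟩
  have hne : i ≠ j := by rintro rfl; exact lt_irrefl _ hlt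
  exact (h i hi j hj hne).resolve_right fun hb => hlt.not_gt hb.pos_lt

theorem Ordered.pos_inj {S : RegionSet ι} (h : S.Ordered) {i j : ι} (hi : i ∈ S.idx)
    (hj : j ∈ S.idx) (he : S.pos i = S.pos j) : i = j := by
  by_contra hne
  rcases h i hi j hj hne with hb | hb
  · exact hb.pos_lt.ne he
  · exact hb.pos_lt.ne' he

theorem Ordered.between_iff {S : RegionSet ι} (h : S.Ordered) {i j k : ι} (hi : i ∈ S.idx)
    (hj : j ∈ S.idx) (hk : k ∈ S.idx) :
    S.Between i j k ↔ S.pos k ∈ Set.uIcc (S.pos i) (S.pos j) := by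
  rw [Between, h.before_iff hi hk, h.before_iff hk hj, h.before_iff hj hk, h.before_iff hk hi,
    Set.mem_uIcc]
  constructor
  · rintro (rfl | rfl | h | h)
    · exact (le_total (S.pos k) (S.pos j)).imp (fun h => ⟨le_rfl, h⟩) fun h => ⟨h, le_rfl⟩
    · exact (le_total (S.pos i) (S.pos k)).imp (fun h => ⟨h, le_rfl⟩) fun h => ⟨le_rfl, h⟩
    · exact .inl ⟨h.1.le, h.2.le⟩
    · exact .inr ⟨h.1.le, h.2.le⟩
  · by_cases h1 : k = i
    · exact fun _ => .inl h1
    by_cases h2 : k = j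
    · exact fun _ => .inr (.inl h2)
    have h1' : S.pos k ≠ S.pos i := fun e => h1 (h.pos_inj hk hi e)
    have h2' : S.pos k ≠ S.pos j := fun e => h2 (h.pos_inj hk hj e)
    rintro (⟨h3, h4⟩ | ⟨h3, h4⟩)
    · exact .inr (.inr (.inl ⟨lt_of_le_of_ne h3 h1'.symm, lt_of_le_of_ne h4 h2'⟩))
    · exact .inr (.inr (.inr ⟨lt_of_le_of_ne h3 h2'.symm, lt_of_le_of_ne h4 h1'⟩))

theorem mem_culled_idx {R : RegionSet ι} {i : ι} :
    i ∈ R.culled.idx ↔ i ∈ R.idx ∧ ¬ (R.IsSource i ∧ R.IsSink i) := by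
  classical
  simp [culled]

theorem culled_idx_subset (R : RegionSet ι) : R.culled.idx ⊆ R.idx := fun _ h =>
  (mem_culled_idx.1 h).1

theorem before_culled {R : RegionSet ι} {i j : ι} (hi : i ∈ R.culled.idx)
    (hj : j ∈ R.culled.idx) : R.culled.Before i j ↔ R.Before i j :=
  ⟨fun h => ⟨culled_idx_subset R hi, culled_idx_subset R hj, h.2.2⟩, fun h => ⟨hi, hj, h.2.2⟩⟩

/-- Removing isolated regions does not change which of the other regions are sinks. -/
theorem isSink_culled {R : RegionSet ι} (hg : R.Generic) (ho : R.Ordered) {i : ι}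
    (hi : i ∈ R.culled.idx) : R.culled.IsSink i ↔ R.IsSink i := by
  have hsub := culled_idx_subset R
  rw [isSink_iff (hg.mono hsub rfl) (ho.mono hsub rfl), isSink_iff hg ho]
  constructor
  · refine fun h => ⟨hsub hi, fun k => ⟨fun hb => ?_, fun hb => ?_⟩⟩
    · by_contra hc
      have hk : k ∈ R.culled.idx := mem_culled_idx.2 ⟨hb.2.1, fun hs =>
        hc (((isSource_iff hg ho).1 hs.1).2 i |>.1 hb)⟩
      exact hc ((h.2 k).1 ((before_culled hi hk).2 hb))
    · by_contra hc
      have hk : k ∈ R.culled.idx := mem_culled_idx.2 ⟨hb.1, fun hs =>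
        hc (((isSource_iff hg ho).1 hs.1).2 i |>.2 hb)⟩
      exact hc ((h.2 k).2 ((before_culled hk hi).2 hb))
  · refine fun h => ⟨hi, fun k => ⟨fun hb => ?_, fun hb => ?_⟩⟩
    · exact (h.2 k).1 ((before_culled hi hb.2.1).1 hb)
    · exact (h.2 k).2 ((before_culled hb.1 hi).1 hb)

section Block

variable {S : RegionSet ι} {i j : ι}

theorem block_of_not_isSink (hi : ¬ S.IsSink i) : S.block i = {i} := if_neg hi

theorem mem_block_of_isSink (ho : S.Ordered) (hi : S.IsSink i) : j ∈ S.block i ↔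
    j ∈ S.idx ∧ ∀ k ∈ S.idx, S.pos k ∈ Set.uIcc (S.pos i) (S.pos j) → S.IsSink k := by
  classical
  rw [block, if_pos hi, Finset.mem_filter]
  refine and_congr_right fun hj => forall₂_congr fun k hk => ?_
  rw [ho.between_iff hi.1 hj hk]

theorem self_mem_block (ho : S.Ordered) (i : ι) : i ∈ S.block i := by
  by_cases hs : S.IsSink i
  · refine (mem_block_of_isSink ho hs).2 ⟨hs.1, fun k hk h => ?_⟩
    rw [Set.uIcc_self, Set.mem_singleton_iff] at h
    rwa [ho.pos_inj hk hs.1 h]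
  · simp [block_of_not_isSink hs]

theorem block_subset (ho : S.Ordered) (hi : i ∈ S.idx) : S.block i ⊆ S.idx := fun j hj => by
  by_cases hs : S.IsSink i
  · exact ((mem_block_of_isSink ho hs).1 hj).1
  · rw [block_of_not_isSink hs, Finset.mem_singleton] at hj
    exact hj ▸ hi

theorem isSink_of_mem_block (ho : S.Ordered) (hs : S.IsSink i) (hj : j ∈ S.block i) :
    S.IsSink j :=
  ((mem_block_of_isSink ho hs).1 hj).2 j ((mem_block_of_isSink ho hs).1 hj).1 Set.right_mem_uIcc

theorem block_subset_block (ho : S.Ordered) (hi : S.IsSink i) (hj : S.IsSink j)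
    (h : ∀ k ∈ S.idx, S.pos k ∈ Set.uIcc (S.pos i) (S.pos j) → S.IsSink k) :
    S.block i ⊆ S.block j := fun t ht => by
  rw [mem_block_of_isSink ho hi] at ht
  rw [mem_block_of_isSink ho hj]
  refine ⟨ht.1, fun k hk hkt => ?_⟩
  rcases Set.uIcc_subset_uIcc_union_uIcc (b := S.pos i) hkt with h' | h'
  · exact h k hk (Set.uIcc_comm (S.pos i) (S.pos j) ▸ h')
  · exact ht.2 k hk h'

/-- Two different blocks are separated in the order of the regions; if both consist of sinks, then
by a region that is not a sink. -/
theorem blocks_separated (ho : S.Ordered) (hi : i ∈ S.idx) (hj : j ∈ S.idx)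
    (hne : S.block i ≠ S.block j) (hlt : S.pos i < S.pos j) :
    (∀ s ∈ S.block i, ∀ t ∈ S.block j, S.pos s < S.pos t) ∧
    (S.IsSink i → S.IsSink j → ∃ k ∈ S.idx, ¬ S.IsSink k ∧
      (∀ s ∈ S.block i, S.pos s < S.pos k) ∧ ∀ t ∈ S.block j, S.pos k < S.pos t) := by
  have key1 : ∀ i, S.IsSink i → ∀ k ∈ S.idx, ¬ S.IsSink k → S.pos i < S.pos k →
      ∀ s ∈ S.block i, S.pos s < S.pos k := fun i hi k hk hks hlt s hs => by
    by_contra! hc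
    exact hks (((mem_block_of_isSink ho hi).1 hs).2 k hk (Set.mem_uIcc.2 (.inl ⟨hlt.le, hc⟩)))
  have key2 : ∀ j, S.IsSink j → ∀ k ∈ S.idx, ¬ S.IsSink k → S.pos k < S.pos j →
      ∀ t ∈ S.block j, S.pos k < S.pos t := fun j hj k hk hks hlt t ht => by
    by_contra! hc
    exact hks (((mem_block_of_isSink ho hj).1 ht).2 k hk (Set.mem_uIcc.2 (.inr ⟨hc, hlt.le⟩)))
  by_cases si : S.IsSink i <;> by_cases sj : S.IsSink j
  · obtain ⟨k, hk, hkm, hks⟩ : ∃ k ∈ S.idx, S.pos k ∈ Set.uIcc (S.pos i) (S.pos j) ∧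
        ¬ S.IsSink k := by
      by_contra! hc
      refine hne (Finset.Subset.antisymm (block_subset_block ho si sj hc)
        (block_subset_block ho sj si ?_))
      rwa [Set.uIcc_comm]
    rw [Set.uIcc_of_le hlt.le] at hkm
    have hki : S.pos i ≠ S.pos k := fun e => hks (ho.pos_inj hi hk e ▸ si)
    have hkj : S.pos k ≠ S.pos j := fun e => hks (ho.pos_inj hk hj e ▸ sj)
    have h1 := key1 i si k hk hks (lt_of_le_of_ne hkm.1 hki)
    have h2 := key2 j sj k hk hks (lt_of_le_of_ne hkm.2 hkj)
    exact ⟨fun s hs t ht => (h1 s hs).trans (h2 t ht), fun _ _ => ⟨k, hk, hks, h1, h2⟩⟩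
  · refine ⟨fun s hs t ht => ?_, fun _ h => absurd h sj⟩
    rw [block_of_not_isSink sj, Finset.mem_singleton] at ht
    exact ht ▸ key1 i si j hj sj hlt s hs
  · refine ⟨fun s hs t ht => ?_, fun h => absurd h si⟩
    rw [block_of_not_isSink si, Finset.mem_singleton] at hs
    exact hs ▸ key2 j sj i hi si hlt t ht
  · refine ⟨fun s hs t ht => ?_, fun h => absurd h si⟩
    rw [block_of_not_isSink si, Finset.mem_singleton] at hs
    rw [block_of_not_isSink sj, Finset.mem_singleton] at ht
    rwa [hs, ht]

end Block

/-- The relation between a truncated set `R` and its canonical set `K`: every region of `K` is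
spanned by a first member `f B` and a last member `l B` of the block `B`. -/
structure Blocks (R : RegionSet ι) (K : RegionSet (Finset ι)) (f l : Finset ι → ι) : Prop where
  subset : ∀ B ∈ K.idx, B ⊆ R.idx
  f_mem : ∀ B ∈ K.idx, f B ∈ B
  l_mem : ∀ B ∈ K.idx, l B ∈ B
  lo_fst : ∀ B ∈ K.idx, (K.rect B).lo.1 = (R.rect (f B)).lo.1
  lo_snd : ∀ B ∈ K.idx, (K.rect B).lo.2 = (R.rect (l B)).lo.2
  hi_fst : ∀ B ∈ K.idx, (K.rect B).hi.1 = (R.rect (l B)).hi.1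
  hi_snd : ∀ B ∈ K.idx, (K.rect B).hi.2 = (R.rect (f B)).hi.2
  first : ∀ B ∈ K.idx, ∀ s ∈ B, s = f B ∨ R.Before (f B) s
  last : ∀ B ∈ K.idx, ∀ s ∈ B, s = l B ∨ R.Before s (l B)
  before : ∀ B ∈ K.idx, ∀ B' ∈ K.idx, B ≠ B' →
    (∀ s ∈ B, ∀ t ∈ B', R.Before s t) ∨ ∀ s ∈ B, ∀ t ∈ B', R.Before t s
  not_isolated : ∀ B ∈ K.idx, ∀ i ∈ B, ¬ (R.IsSource i ∧ R.IsSink i)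
  sink_or : ∀ B ∈ K.idx, (∃ i, B = {i} ∧ ¬ R.IsSink i) ∨ ∀ i ∈ B, R.IsSink i
  singleton_mem : ∀ i ∈ R.idx, ¬ R.IsSink i → {i} ∈ K.idx
  split : ∀ B ∈ K.idx, ∀ B' ∈ K.idx, (∀ i ∈ B, R.IsSink i) → (∀ i ∈ B', R.IsSink i) →
    (∀ s ∈ B, ∀ t ∈ B', R.Before s t) →
    ∃ k ∈ R.idx, ¬ R.IsSink k ∧ (∀ s ∈ B, R.Before s k) ∧ ∀ t ∈ B', R.Before k t

theorem Blocks.swap {R : RegionSet ι} {K : RegionSet (Finset ι)} {f l : Finset ι → ι}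
    (h : Blocks R K f l) : Blocks R.swap K.swap l f where
  subset := h.subset
  f_mem := h.l_mem
  l_mem := h.f_mem
  lo_fst := h.lo_snd
  lo_snd := h.lo_fst
  hi_fst := h.hi_snd
  hi_snd := h.hi_fst
  first B hB s hs := by rw [before_swap]; exact h.last B hB s hs
  last B hB s hs := by rw [before_swap]; exact h.first B hB s hs
  before B hB B' hB' hne := by
    simp only [before_swap]
    exact (h.before B hB B' hB' hne).symm
  not_isolated := by simp only [isSource_swap, isSink_swap]; exact h.not_isolated
  sink_or := by simp only [isSink_swap]; exact h.sink_or
  singleton_mem := by simp only [isSink_swap]; exact h.singleton_mem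
  split B hB B' hB' hs hs' hb := by
    simp only [isSink_swap, before_swap] at *
    obtain ⟨k, hk, hks, h1, h2⟩ := h.split B' hB' B hB hs' hs fun s hs t ht => hb t ht s hs
    exact ⟨k, hk, hks, h2, h1⟩

theorem hull_singleton (S : RegionSet ι) (i : ι) : S.hull {i} = S.rect i := by
  simp [hull]

theorem exists_first_last {S : RegionSet ι} (ho : S.Ordered) {B : Finset ι} (hB : B ⊆ S.idx)
    (hne : B.Nonempty) : ∃ f ∈ B, ∃ l ∈ B, ∀ s ∈ B,
      (s = f ∨ S.Before f s) ∧ (s = l ∨ S.Before s l) := by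
  obtain ⟨f, hf, hmin⟩ := Finset.exists_min_image B S.pos hne
  obtain ⟨l, hl, hmax⟩ := Finset.exists_max_image B S.pos hne
  refine ⟨f, hf, l, hl, fun s hs => ⟨?_, ?_⟩⟩
  · refine or_iff_not_imp_left.2 fun hsf => (ho.before_iff (hB hf) (hB hs)).2 ?_
    exact lt_of_le_of_ne (hmin s hs) fun e => hsf (ho.pos_inj (hB hf) (hB hs) e).symm
  · refine or_iff_not_imp_left.2 fun hsl => (ho.before_iff (hB hs) (hB hl)).2 ?_
    exact lt_of_le_of_ne (hmax s hs) fun e => hsl (ho.pos_inj (hB hs) (hB hl) e)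

/-- The right and the top sides of consecutive sinks are monotone along the order, so the smallest
rectangle containing them is determined by the first and the last one. -/
theorem hull_eq {S : RegionSet ι} (hg : S.Generic) (ho : S.Ordered) {B : Finset ι}
    (hB : ∀ i ∈ B, S.IsSink i) {f l : ι} (hf : f ∈ B) (hl : l ∈ B)
    (h : ∀ s ∈ B, (s = f ∨ S.Before f s) ∧ (s = l ∨ S.Before s l)) :
    (S.hull B).lo = ((S.rect f).lo.1, (S.rect l).lo.2) ∧
      (S.hull B).hi = ((S.rect l).hi.1, (S.rect f).hi.2) := by
  have hne : B.Nonempty := ⟨f, hf⟩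
  rw [hull, dif_pos hne]
  constructor
  · refine le_antisymm (Prod.mk_le_mk.2 ⟨(Finset.inf'_le (fun i => (S.rect i).lo) hf).1,
      (Finset.inf'_le (fun i => (S.rect i).lo) hl).2⟩)
      (Finset.le_inf' hne _ fun s hs => Prod.mk_le_mk.2 ⟨?_, ?_⟩)
    · rcases (h s hs).1 with rfl | hb
      exacts [le_rfl, hb.2.2.1]
    · rcases (h s hs).2 with rfl | hb
      exacts [le_rfl, hb.2.2.2.1]
  · refine le_antisymm (Finset.sup'_le hne _ fun s hs => Prod.mk_le_mk.2 ⟨?_, ?_⟩)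
      (Prod.mk_le_mk.2 ⟨(Finset.le_sup' (fun i => (S.rect i).hi) hl).1,
        (Finset.le_sup' (fun i => (S.rect i).hi) hf).2⟩)
    · rcases (h s hs).2 with rfl | hb
      · exact le_rfl
      · exact ((((isSink_iff hg ho).1 (hB s hs)).2 l).1 hb).trans (S.rect l).le.1
    · rcases (h s hs).1 with rfl | hb
      · exact le_rfl
      · exact ((((isSink_iff hg ho).1 (hB s hs)).2 f).2 hb).trans (S.rect f).le.2

theorem exists_blocks [Nonempty ι] {R : RegionSet ι} (hg : R.Generic) (ho : R.Ordered) :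
    ∃ f l, Blocks R R.canonical f l := by
  classical
  have hsub := culled_idx_subset R
  have hgS := hg.mono hsub rfl
  have hoS := ho.mono hsub rfl
  have hmem : ∀ B, B ∈ R.canonical.idx ↔ ∃ i ∈ R.culled.idx, R.culled.block i = B := fun B => by
    simp [canonical]
  have hBS : ∀ B ∈ R.canonical.idx, B ⊆ R.culled.idx := fun B hB => by
    obtain ⟨i, hi, rfl⟩ := (hmem B).1 hB
    exact block_subset hoS hi
  have hout : ∀ B ∈ R.canonical.idx,
      (∃ i, B = {i} ∧ ¬ R.culled.IsSink i) ∨ ∀ i ∈ B, R.culled.IsSink i := fun B hB => by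
    obtain ⟨i, hi, rfl⟩ := (hmem B).1 hB
    by_cases hs : R.culled.IsSink i
    · exact .inr fun j hj => isSink_of_mem_block hoS hs hj
    · exact .inl ⟨i, block_of_not_isSink hs, hs⟩
  have hb : ∀ B ∈ R.canonical.idx, ∀ s ∈ B, s ∈ R.culled.idx := fun B hB s hs => hBS B hB hs
  have hex : ∀ B, ∃ f l, B ∈ R.canonical.idx → f ∈ B ∧ l ∈ B ∧
      (∀ s ∈ B, (s = f ∨ R.Before f s) ∧ (s = l ∨ R.Before s l)) ∧
      (R.canonical.rect B).lo = ((R.rect f).lo.1, (R.rect l).lo.2) ∧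
      (R.canonical.rect B).hi = ((R.rect l).hi.1, (R.rect f).hi.2) := fun B => by
    by_cases hB : B ∈ R.canonical.idx
    · rcases hout B hB with ⟨i, rfl, -⟩ | hs
      · refine ⟨i, i, fun _ => ⟨by simp, by simp, by simp, ?_⟩⟩
        change (R.culled.hull {i}).lo = _ ∧ (R.culled.hull {i}).hi = _
        rw [hull_singleton]
        exact ⟨rfl, rfl⟩
      · have hne : B.Nonempty := by
          obtain ⟨i, hi, rfl⟩ := (hmem B).1 hB
          exact ⟨i, self_mem_block hoS i⟩
        obtain ⟨f, hf, l, hl, h⟩ := exists_first_last hoS (hBS B hB) hne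
        have hh := hull_eq hgS hoS hs hf hl h
        refine ⟨f, l, fun _ => ⟨hf, hl, fun s hs => ?_, hh⟩⟩
        rw [← before_culled (hb B hB f hf) (hb B hB s hs),
          ← before_culled (hb B hB s hs) (hb B hB l hl)]
        exact h s hs
    · exact ⟨Classical.arbitrary ι, Classical.arbitrary ι, fun h => absurd h hB⟩
  choose f l hfl using hex
  have hsepB : ∀ B ∈ R.canonical.idx, ∀ B' ∈ R.canonical.idx, B ≠ B' →
      (∀ s ∈ B, ∀ t ∈ B', R.Before s t) ∧ ((∀ i ∈ B, R.IsSink i) → (∀ i ∈ B', R.IsSink i) →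
        ∃ k ∈ R.idx, ¬ R.IsSink k ∧ (∀ s ∈ B, R.Before s k) ∧ ∀ t ∈ B', R.Before k t) ∨
      ∀ s ∈ B, ∀ t ∈ B', R.Before t s := by
    intro B hB B' hB' hne
    have hlt : ∀ s ∈ R.culled.idx, ∀ t ∈ R.culled.idx, R.culled.pos s < R.culled.pos t →
        R.Before s t := fun s hs t ht h =>
      (before_culled hs ht).1 ((hoS.before_iff hs ht).2 h)
    obtain ⟨i, hi, hiB⟩ := (hmem B).1 hB
    obtain ⟨j, hj, hjB⟩ := (hmem B').1 hB'
    have hij : i ≠ j := by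
      rintro rfl
      exact hne (hiB.symm.trans hjB)
    rcases lt_or_gt_of_ne (fun e => hij (hoS.pos_inj hi hj e)) with h | h
    · obtain ⟨h1, h2⟩ := blocks_separated hoS hi hj (by rwa [hiB, hjB]) h
      rw [hiB, hjB] at h1 h2
      refine .inl ⟨fun s hs t ht => hlt s (hb B hB s hs) t (hb B' hB' t ht) (h1 s hs t ht),
        fun k1 k2 => ?_⟩
      obtain ⟨k, hk, hks, h3, h4⟩ := h2
        ((isSink_culled hg ho hi).2 (k1 i (hiB ▸ self_mem_block hoS i)))
        ((isSink_culled hg ho hj).2 (k2 j (hjB ▸ self_mem_block hoS j)))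
      exact ⟨k, hsub hk, fun h => hks ((isSink_culled hg ho hk).2 h),
        fun s hs => hlt s (hb B hB s hs) k hk (h3 s hs),
        fun t ht => hlt k hk t (hb B' hB' t ht) (h4 t ht)⟩
    · obtain ⟨h1, -⟩ := blocks_separated hoS hj hi (by rw [hiB, hjB]; exact hne.symm) h
      rw [hiB, hjB] at h1
      exact .inr fun s hs t ht => hlt t (hb B' hB' t ht) s (hb B hB s hs) (h1 t ht s hs)
  refine ⟨f, l, ?_⟩
  constructor
  · exact fun B hB => (hBS B hB).trans hsub
  · exact fun B hB => (hfl B hB).1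
  · exact fun B hB => (hfl B hB).2.1
  · exact fun B hB => (Prod.ext_iff.1 (hfl B hB).2.2.2.1).1
  · exact fun B hB => (Prod.ext_iff.1 (hfl B hB).2.2.2.1).2
  · exact fun B hB => (Prod.ext_iff.1 (hfl B hB).2.2.2.2).1
  · exact fun B hB => (Prod.ext_iff.1 (hfl B hB).2.2.2.2).2
  · exact fun B hB s hs => ((hfl B hB).2.2.1 s hs).1
  · exact fun B hB s hs => ((hfl B hB).2.2.1 s hs).2
  · exact fun B hB B' hB' hne => (hsepB B hB B' hB' hne).imp_left And.left
  · exact fun B hB i hi => (mem_culled_idx.1 (hb B hB i hi)).2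
  · intro B hB
    rcases hout B hB with ⟨i, rfl, hi⟩ | h
    · exact .inl ⟨i, rfl, fun h => hi
        ((isSink_culled hg ho (hb _ hB i (Finset.mem_singleton_self i))).2 h)⟩
    · exact .inr fun i hi => (isSink_culled hg ho (hb B hB i hi)).1 (h i hi)
  · intro i hi hs
    have hiS : i ∈ R.culled.idx := mem_culled_idx.2 ⟨hi, fun h => hs h.2⟩
    exact (hmem _).2 ⟨i, hiS, block_of_not_isSink fun h => hs ((isSink_culled hg ho hiS).1 h)⟩
  · intro B hB B' hB' hs hs' hbb
    have hf := (hfl B hB).1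
    have hf' := (hfl B' hB').1
    have hne : B ≠ B' := fun e => (hbb (f B) hf (f B) (e ▸ hf)).ne rfl
    rcases hsepB B hB B' hB' hne with h | h
    · exact h.2 hs hs'
    · exact absurd (hbb _ hf _ hf') (h _ hf _ hf').asymm

namespace Blocks

variable {R : RegionSet ι} {K : RegionSet (Finset ι)} {f l : Finset ι → ι}

theorem before_of_forall (h : Blocks R K f l) {B B' : Finset ι} (hB : B ∈ K.idx)
    (hB' : B' ∈ K.idx) (hb : ∀ s ∈ B, ∀ t ∈ B', R.Before s t) : K.Before B B' := by
  have h1 := hb _ (h.f_mem B hB) _ (h.f_mem B' hB')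
  have h2 := hb _ (h.l_mem B hB) _ (h.l_mem B' hB')
  have h3 := hb _ (h.l_mem B hB) _ (h.f_mem B' hB')
  have h4 : (R.rect (f B)).lo.1 ≤ (R.rect (l B)).lo.1 := by
    rcases h.last B hB _ (h.f_mem B hB) with e | e
    exacts [(congrArg (fun i => (R.rect i).lo.1) e).le, e.2.2.1]
  have h5 : (R.rect (l B')).lo.2 ≤ (R.rect (f B')).lo.2 := by
    rcases h.last B' hB' _ (h.f_mem B' hB') with e | e
    exacts [(congrArg (fun i => (R.rect i).lo.2) e).ge, e.2.2.2.1]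
  refine ⟨hB, hB', ?_, ?_, fun e => h3.2.2.2.2 ?_⟩
  · rw [h.lo_fst B hB, h.lo_fst B' hB']
    exact h1.2.2.1
  · rw [h.lo_snd B hB, h.lo_snd B' hB']
    exact h2.2.2.2.1
  · have e1 := congrArg Prod.fst e
    have e2 := congrArg Prod.snd e
    rw [h.lo_fst B hB, h.lo_fst B' hB'] at e1
    rw [h.lo_snd B hB, h.lo_snd B' hB'] at e2
    exact Prod.ext (le_antisymm h3.2.2.1 (e1.ge.trans h4))
      (le_antisymm (e2.le.trans h5) h3.2.2.2.1)

theorem ordered (h : Blocks R K f l) : K.Ordered := fun B hB B' hB' hne =>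
  (h.before B hB B' hB' hne).imp (h.before_of_forall hB hB') fun hb =>
    h.before_of_forall hB' hB fun t ht s hs => hb s hs t ht

theorem before_of_before (h : Blocks R K f l) {B B' : Finset ι} (hb : K.Before B B') {s t : ι}
    (hs : s ∈ B) (ht : t ∈ B') : R.Before s t :=
  (h.before B hb.1 B' hb.2.1 hb.ne).resolve_right (fun hb' =>
    hb.asymm (h.before_of_forall hb.2.1 hb.1 fun t ht s hs => hb' s hs t ht)) s hs t ht

theorem last_before_first (h : Blocks R K f l) {B B' : Finset ι} (hb : K.Before B B') :
    R.Before (l B) (f B') := h.before_of_before hb (h.l_mem B hb.1) (h.f_mem B' hb.2.1)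

theorem ne_of_mem (h : Blocks R K f l) {B B' : Finset ι} (hB : B ∈ K.idx) (hB' : B' ∈ K.idx)
    (hne : B ≠ B') {s t : ι} (hs : s ∈ B) (ht : t ∈ B') : s ≠ t := by
  rcases h.before B hB B' hB' hne with hb | hb
  exacts [(hb s hs t ht).ne, (hb s hs t ht).ne.symm]

theorem generic (h : Blocks R K f l) (hg : R.Generic) : K.Generic := by
  have hsep : ∀ B B', K.Before B B' →
      (K.rect B).hi.1 < (K.rect B').lo.1 ∨ (K.rect B').hi.2 < (K.rect B).lo.2 := by
    intro B B' hb
    rw [h.hi_fst B hb.1, h.lo_fst B' hb.2.1, h.hi_snd B' hb.2.1, h.lo_snd B hb.1]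
    exact hg.disj.sep (h.last_before_first hb)
  refine ⟨fun B hB B' hB' hne => ?_, fun B hB B' hB' hne => ?_, fun B hB B' hB' hne => ?_,
    fun B hB B' hB' hne e => ?_, fun B hB B' hB' hne e => ?_⟩
  · rw [disjoint_carrier]
    rcases h.ordered B hB B' hB' hne with hb | hb
    · have := hsep _ _ hb
      tauto
    · have := hsep _ _ hb
      tauto
  · rw [h.hi_fst B hB, h.hi_fst B' hB']
    exact hg.hi_fst _ (h.subset B hB (h.l_mem B hB)) _ (h.subset B' hB' (h.l_mem B' hB'))
      (h.ne_of_mem hB hB' hne (h.l_mem B hB) (h.l_mem B' hB'))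
  · rw [h.hi_snd B hB, h.hi_snd B' hB']
    exact hg.hi_snd _ (h.subset B hB (h.f_mem B hB)) _ (h.subset B' hB' (h.f_mem B' hB'))
      (h.ne_of_mem hB hB' hne (h.f_mem B hB) (h.f_mem B' hB'))
  · rw [h.hi_fst B hB, h.lo_fst B' hB'] at e
    rcases h.ordered B hB B' hB' hne with hb | hb
    · refine (hsep _ _ hb).resolve_left fun hc => ?_
      rw [h.hi_fst B hB, h.lo_fst B' hB'] at hc
      exact hc.ne e
    · exact absurd e.symm
        (hg.lo_fst_ne (h.before_of_before hb (h.f_mem B' hB') (h.l_mem B hB)))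
  · rw [h.hi_snd B hB, h.lo_snd B' hB'] at e
    rcases h.ordered B hB B' hB' hne with hb | hb
    · exact absurd e.symm (hg.swap.lo_fst_ne (before_swap.2
        (h.before_of_before hb (h.f_mem B hB) (h.l_mem B' hB'))))
    · refine (hsep _ _ hb).resolve_right fun hc => ?_
      rw [h.hi_snd B hB, h.lo_snd B' hB'] at hc
      exact hc.ne e

theorem singleton_eq (h : Blocks R K f l) {i : ι} (hi : {i} ∈ K.idx) :
    f {i} = i ∧ l {i} = i :=
  ⟨Finset.mem_singleton.1 (h.f_mem _ hi), Finset.mem_singleton.1 (h.l_mem _ hi)⟩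

theorem rect_singleton (h : Blocks R K f l) {i : ι} (hi : {i} ∈ K.idx) :
    (K.rect {i}).lo = (R.rect i).lo ∧ (K.rect {i}).hi = (R.rect i).hi := by
  have h1 := h.lo_fst _ hi
  have h2 := h.lo_snd _ hi
  have h3 := h.hi_fst _ hi
  have h4 := h.hi_snd _ hi
  rw [(h.singleton_eq hi).1] at h1 h4
  rw [(h.singleton_eq hi).2] at h2 h3
  exact ⟨Prod.ext h1 h2, Prod.ext h3 h4⟩

theorem lo_le_lo_first (h : Blocks R K f l) {B : Finset ι} (hB : B ∈ K.idx) :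
    (K.rect B).lo ≤ (R.rect (f B)).lo := by
  refine ⟨(h.lo_fst B hB).le, (h.lo_snd B hB).le.trans ?_⟩
  rcases h.last B hB _ (h.f_mem B hB) with e | e
  exacts [(congrArg (fun i => (R.rect i).lo.2) e).ge, e.2.2.2.1]

/-- If the first and the last member agree, then the block is a singleton. -/
theorem eq_singleton (h : Blocks R K f l) {B : Finset ι} (hB : B ∈ K.idx) (e : f B = l B) :
    B = {f B} := by
  refine Finset.eq_singleton_iff_unique_mem.2 ⟨h.f_mem B hB, fun s hs => ?_⟩
  rcases h.first B hB s hs with e1 | h1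
  · exact e1
  · rcases h.last B hB s hs with e2 | h2
    · exact e2.trans e.symm
    · exact absurd (e ▸ h1) h2.asymm

/-- In the canonical set, a block of sinks is not a source: it would consist of isolated
regions. -/
theorem not_isSource (h : Blocks R K f l) (hg : R.Generic) (ho : R.Ordered) {B : Finset ι}
    (hB : B ∈ K.idx) (hs : ∀ i ∈ B, R.IsSink i) : ¬ K.IsSource B := by
  intro hsrc
  rw [isSource_iff (h.generic hg) h.ordered] at hsrc
  have hf := h.f_mem B hB
  refine h.not_isolated B hB _ hf ⟨(isSource_iff hg ho).2 ⟨h.subset B hB hf, fun j => ?_⟩,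
    hs _ hf⟩
  have key : ∀ j, j ∈ R.idx → ¬ R.IsSink j → {j} ∈ K.idx ∧ B ≠ {j} := fun j hj hjs =>
    ⟨h.singleton_mem j hj hjs, fun e => hjs (hs j (e ▸ Finset.mem_singleton_self j))⟩
  constructor
  · intro hb
    by_contra hc
    obtain ⟨hjK, hne⟩ := key j hb.1 fun hjs =>
      hc ((((isSink_iff hg ho).1 hjs).2 _).1 hb)
    rcases h.ordered B hB _ hjK hne with hb' | hb'
    · exact hb.asymm (h.before_of_before hb' hf (Finset.mem_singleton_self j))
    · have := (hsrc.2 _).1 hb'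
      rw [(h.rect_singleton hjK).2, h.lo_fst B hB] at this
      exact hc this
  · intro hb
    by_contra hc
    obtain ⟨hjK, hne⟩ := key j hb.2.1 fun hjs =>
      hc ((((isSink_iff hg ho).1 hjs).2 _).2 hb)
    rcases h.ordered B hB _ hjK hne with hb' | hb'
    · have := (hsrc.2 _).2 hb'
      rw [(h.rect_singleton hjK).2] at this
      exact hc (this.trans (h.lo_le_lo_first hB).2)
    · exact hb.asymm (h.before_of_before hb' (Finset.mem_singleton_self j) hf)

/-- A block of sinks does not overlap any other region of the canonical set from its side. -/
theorem hi_le_lo_of_sinks (h : Blocks R K f l) (hg : R.Generic) (ho : R.Ordered) {B B' : Finset ι}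
    (hs : ∀ i ∈ B, R.IsSink i) (hb : K.Before B B') : (K.rect B).hi.1 ≤ (K.rect B').lo.1 := by
  rw [h.hi_fst B hb.1, h.lo_fst B' hb.2.1]
  exact (((isSink_iff hg ho).1 (hs _ (h.l_mem B hb.1))).2 _).1 (h.last_before_first hb)

end Blocks

/-! ### Points on the Pareto front -/

/-- The point of `k` is not dominated by another point. -/
def OnFront (O : RegionSet ι) (P : ι → ℝ × ℝ) (k : ι) : Prop :=
  k ∈ O.idx ∧ ∀ j ∈ O.idx, j ≠ k → ¬ P k ≤ P j

/-- The regions of the truncated set that are not sinks and have their points on the Pareto front,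
as regions of the canonical set. -/
def frontSet (O : RegionSet ι) (P : ι → ℝ × ℝ) : Set (Finset ι) :=
  {B | ∃ k, B = {k} ∧ O.OnFront P k ∧ ¬ O.trunc.IsSink k}

/-- Disjoint regions `O` in general position with points `P`, a family `K` that arises from their
truncation by merging blocks of sinks, and the points `q` of the regions of `K` that are not
compound. -/
structure Config (O : RegionSet ι) (P : ι → ℝ × ℝ) (K : RegionSet (Finset ι))
    (f l : Finset ι → ι) (q : Finset ι → ℝ × ℝ) : Prop where
  disj : O.PairwiseDisjoint
  resp : O.Respects P
  gen : O.GeneralPosition P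
  blocks : Blocks O.trunc K f l
  point : ∀ i, q {i} = P i

namespace Config

variable {O : RegionSet ι} {P : ι → ℝ × ℝ} {K : RegionSet (Finset ι)} {f l : Finset ι → ι}
  {q : Finset ι → ℝ × ℝ}

theorem swap (h : Config O P K f l q) :
    Config O.swap (fun i => (P i).swap) K.swap l f (fun B => (q B).swap) where
  disj := by
    intro i hi j hj hij
    have := disjoint_carrier.1 (h.disj i hi j hj hij)
    refine disjoint_carrier.2 ?_
    simp only [RegionSet.swap, Rect.swap, Prod.fst_swap, Prod.snd_swap]
    tauto
  resp := h.resp.swap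
  gen := h.gen.swap
  blocks := by rw [trunc_swap]; exact h.blocks.swap
  point i := congrArg Prod.swap (h.point i)

theorem onFront_swap {k : ι} : O.swap.OnFront (fun i => (P i).swap) k ↔ O.OnFront P k :=
  and_congr_right fun _ => forall₃_congr fun _ _ _ =>
    not_congr ⟨fun h => ⟨h.2, h.1⟩, fun h => ⟨h.2, h.1⟩⟩

theorem frontSet_swap : O.swap.frontSet (fun i => (P i).swap) = O.frontSet P := by
  simp only [frontSet, onFront_swap, trunc_swap, isSink_swap]

theorem trunc_generic (h : Config O P K f l q) : O.trunc.Generic :=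
  generic_trunc (h.gen.generic h.disj)

theorem trunc_ordered (h : Config O P K f l q) : O.trunc.Ordered := ordered_trunc h.disj

theorem lo_le_point (h : Config O P K f l q) {i : ι} (hi : i ∈ O.idx) :
    (O.rect i).lo ≤ P i := (h.resp i hi).1

theorem point_le_hi (h : Config O P K f l q) {i : ι} (hi : i ∈ O.idx) :
    P i ≤ (O.trunc.rect i).hi := (h.resp i hi).2

theorem point_inj (h : Config O P K f l q) {i j : ι} (hi : i ∈ O.idx) (hj : j ∈ O.idx)
    (e : (P i).1 = (P j).1) : i = j := by
  by_contra hij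
  exact h.gen.fst_ne hi hj hij (.inr (.inr rfl)) (.inr (.inr rfl)) e

/-- Every point is dominated by a point on the Pareto front. -/
theorem exists_onFront (h : Config O P K f l q) {j : ι} (hj : j ∈ O.idx) :
    ∃ k, O.OnFront P k ∧ P j ≤ P k := by
  classical
  obtain ⟨k, hk, hmax⟩ := Finset.exists_max_image (O.idx.filter fun k => P j ≤ P k)
    (fun k => (P k).1 + (P k).2) ⟨j, Finset.mem_filter.2 ⟨hj, le_rfl⟩⟩
  obtain ⟨hk, hjk⟩ := Finset.mem_filter.1 hk
  refine ⟨k, ⟨hk, fun m hm hmk hle => hmk (h.point_inj hm hk ?_)⟩, hjk⟩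
  have := hmax m (Finset.mem_filter.2 ⟨hm, hjk.trans hle⟩)
  have h1 := hle.1
  have h2 := hle.2
  linarith

theorem mem_trunc (h : Config O P K f l q) {k : ι} (hk : O.OnFront P k) : k ∈ O.trunc.idx :=
  mem_trunc_idx.2 ⟨hk.1, fun hn => by
    obtain ⟨j, hj, hjk, hle⟩ := hn P h.resp
    exact hk.2 j hj hjk hle⟩

theorem mem_carrier (h : Config O P K f l q) {k : ι} (hk : O.OnFront P k) :
    P k ∈ (O.trunc.rect k).carrier := by
  change P k ∈ (O.cut k).carrier
  rw [carrier_cut O h.disj hk.1 (mem_trunc_idx.1 (h.mem_trunc hk)).2]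
  refine ⟨h.resp k hk.1, ?_⟩
  rintro ⟨j, hj, h1, h2⟩
  have hjP := h.lo_le_point hj
  refine hk.2 j hj ?_ ⟨h1.le.trans hjP.1, h2.le.trans hjP.2⟩
  rintro rfl
  exact h1.not_ge hjP.1

theorem isSink_of_lo_eq_hi (h : Config O P K f l q) {k : ι} (hk : k ∈ O.trunc.idx)
    (e : (O.rect k).lo = (O.rect k).hi) : O.trunc.IsSink k := by
  have hle := le_trunc_lo O k
  rw [e] at hle
  exact (isSink_iff h.trunc_generic h.trunc_ordered).2 ⟨hk, fun i =>
    ⟨fun hb => hle.1.trans hb.2.2.1, fun hb => hle.2.trans hb.2.2.2.1⟩⟩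

theorem lo_fst_cases (h : Config O P K f l q) {i : ι} (hi : i ∈ O.trunc.idx) :
    ∃ m ∈ O.idx, (O.trunc.rect i).lo.1 = (O.rect m).lo.1 ∧
      (m = i ∨ (O.rect i).hi.2 < (O.rect m).lo.2) := by
  have hi := (mem_trunc_idx.1 hi).1
  rcases trunc_lo_fst O i with e | ⟨m, hm, hmi, e, hle⟩
  · exact ⟨i, hi, e, .inl rfl⟩
  · exact ⟨m, hm, e, .inr (lt_of_le_of_ne hle
      (h.gen.snd_ne hi hm hmi.symm (.inr (.inl rfl)) (.inl rfl)))⟩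

theorem point_fst_eq_lo (h : Config O P K f l q) {i k : ι} (hi : i ∈ O.idx)
    (hk : k ∈ O.trunc.idx) (hik : i ≠ k) (e : (P i).1 = (O.trunc.rect k).lo.1) :
    (O.trunc.rect k).hi.2 < (P i).2 := by
  obtain ⟨m, hm, e', hor⟩ := h.lo_fst_cases hk
  obtain rfl : i = m := by
    by_contra hne
    exact h.gen.fst_ne hi hm hne (.inr (.inr rfl)) (.inl rfl) (e.trans e')
  exact (hor.resolve_left hik).trans_le (h.lo_le_point hi).2

/-- Even the untruncated region `i` lies strictly above the top side, or strictly to the left of the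
left side, of every later truncated region `k`. So a point of `i` below the guaranteed boundary does
not lie in a rectangle that is spanned by later regions. -/
theorem separated (h : Config O P K f l q) {i k : ι} (hb : O.trunc.Before i k) :
    (O.trunc.rect k).hi.2 < (O.rect i).lo.2 ∨ (O.trunc.rect i).hi.1 < (O.trunc.rect k).lo.1 := by
  rcases h.trunc_generic.disj.sep hb with h1 | h1
  · exact .inr h1
  have hi := (mem_trunc_idx.1 hb.1).1
  rcases trunc_lo_snd O i with e | ⟨m, hm, hmi, e, hle⟩
  · exact .inl (e ▸ h1)
  · refine .inr (lt_of_lt_of_le (lt_of_le_of_ne hle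
      (h.gen.fst_ne hi hm hmi.symm (.inr (.inl rfl)) (.inl rfl))) ?_)
    by_contra! hc
    refine not_belowBoundary_of_mem_trunc h.disj hb.2.1 (z := (O.trunc.rect k).lo)
      ⟨le_rfl, (O.trunc.rect k).le⟩ ⟨m, hm, hc, ?_⟩
    rw [← e]
    exact (O.trunc.rect k).le.2.trans_lt h1

theorem mem_idx (h : Config O P K f l q) {B : Finset ι} (hB : B ∈ K.idx) {i : ι} (hi : i ∈ B) :
    i ∈ O.idx := (mem_trunc_idx.1 (h.blocks.subset B hB hi)).1

theorem point_notMem_of_before (h : Config O P K f l q) {i : ι} {m : Finset ι} (hm : m ∈ K.idx)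
    (hb : O.trunc.Before i (f m)) : P i ∉ (K.rect m).carrier := by
  rintro ⟨⟨h1, -⟩, -, h2⟩
  have hi := (mem_trunc_idx.1 hb.1).1
  rw [h.blocks.hi_snd m hm] at h2
  rw [h.blocks.lo_fst m hm] at h1
  rcases h.separated hb with h3 | h3
  · exact h2.not_gt (h3.trans_le (h.lo_le_point hi).2)
  · exact h1.not_gt ((h.point_le_hi hi).1.trans_lt h3)

theorem point_notMem (h : Config O P K f l q) {i : ι} {m : Finset ι} (hi : {i} ∈ K.idx)
    (hm : m ∈ K.idx) (hne : m ≠ {i}) : P i ∉ (K.rect m).carrier := by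
  rcases h.blocks.before m hm _ hi hne with hb | hb
  · intro hmem
    refine h.swap.point_notMem_of_before (i := i) hm ?_ (mem_carrier_swap.2 hmem)
    rw [trunc_swap, before_swap]
    exact hb _ (h.blocks.l_mem m hm) i (Finset.mem_singleton_self i)
  · exact h.point_notMem_of_before hm (hb _ (h.blocks.f_mem m hm) i (Finset.mem_singleton_self i))

theorem not_isSink_fst (h : Config O P K f l q) {i k : ι} (hb : O.trunc.Before k i)
    (hlt : (O.trunc.rect i).lo.1 < (O.trunc.rect k).hi.1) : ¬ O.trunc.IsSink k := fun hs =>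
  hlt.not_ge ((((isSink_iff h.trunc_generic h.trunc_ordered).1 hs).2 i).1 hb)

theorem not_isSink_snd (h : Config O P K f l q) {i k : ι} (hb : O.trunc.Before i k)
    (hlt : (O.trunc.rect i).lo.2 < (O.trunc.rect k).hi.2) : ¬ O.trunc.IsSink k := fun hs =>
  hlt.not_ge ((((isSink_iff h.trunc_generic h.trunc_ordered).1 hs).2 i).2 hb)

/-- A point on the Pareto front that reaches over a region `c` belongs to a region that overlaps
`c`, and hence to the front set. -/
theorem mem_frontSet_of_reach (h : Config O P K f l q) {c : Finset ι} (hc : c ∈ K.idx) {k : ι}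
    (hk : O.OnFront P k) (h1 : (K.rect c).lo.1 < (P k).1) (h2 : (K.rect c).hi.2 ≤ (P k).2) :
    {k} ∈ O.frontSet P ∧ {k} ≠ c := by
  have hkR := h.mem_trunc hk
  have hg := h.blocks.f_mem c hc
  have hgR := h.blocks.subset c hc hg
  have hkP := h.point_le_hi hk.1
  rw [h.blocks.lo_fst c hc] at h1
  rw [h.blocks.hi_snd c hc] at h2
  have hne : k ≠ f c := by
    rintro hkc
    subst hkc
    -- The point would be the top right vertex of its region, so the region is a point.
    have e : (P (f c)).2 = (O.rect (f c)).hi.2 := le_antisymm hkP.2 h2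
    have ep := (h.gen.own _ hk.1).resolve_right fun hn => hn.2.2.2 e
    have h3 := (le_trunc_lo O (f c)).1
    rw [ep] at h3
    exact (h1.trans_le hkP.1).not_ge h3
  refine ⟨⟨k, rfl, hk, ?_⟩, ?_⟩
  · rcases h.trunc_ordered k hkR _ hgR hne with hb | hb
    · exact h.not_isSink_fst hb (h1.trans_le hkP.1)
    · refine h.not_isSink_snd hb (lt_of_le_of_lt (O.trunc.rect (f c)).le.2
        (lt_of_le_of_ne (h2.trans hkP.2) ?_))
      exact h.trunc_generic.hi_snd _ hgR k hkR hne.symm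
  · rintro rfl
    exact hne (h.blocks.singleton_eq hc).1.symm

theorem exists_lo_le (h : Config O P K f l q) {m : Finset ι} (hm : m ∈ K.idx) :
    ∃ i ∈ O.idx, (K.rect m).lo ≤ (O.rect i).lo := by
  obtain ⟨i, hi, hle⟩ := exists_trunc_lo_le O (h.mem_idx hm (h.blocks.f_mem m hm))
  exact ⟨i, hi, (h.blocks.lo_le_lo_first hm).trans hle⟩

theorem lo_cut (h : Config O P K f l q) {c m : Finset ι} (hc : c ∈ K.idx) (hm : m ∈ K.idx)
    (h1 : (K.rect c).lo.1 < (K.rect m).lo.1) (h2 : (K.rect c).hi.2 ≤ (K.rect m).lo.2) :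
    ∃ e ∈ O.frontSet P, e ≠ c ∧ (K.rect m).lo ≤ q e ∧ (K.rect m).lo.1 < (q e).1 := by
  obtain ⟨i, hi, hle⟩ := h.exists_lo_le hm
  obtain ⟨k, hk, hik⟩ := h.exists_onFront hi
  have hle' : (K.rect m).lo ≤ P k := (hle.trans (h.lo_le_point hi)).trans hik
  obtain ⟨hN, hne⟩ := h.mem_frontSet_of_reach hc hk (h1.trans_le hle'.1) (h2.trans hle'.2)
  refine ⟨{k}, hN, hne, by rwa [h.point], ?_⟩
  rw [h.point]
  refine lt_of_le_of_ne hle'.1 fun e => ?_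
  rw [h.blocks.lo_fst m hm] at e
  obtain ⟨m', hm', e', -⟩ := h.lo_fst_cases (h.blocks.subset m hm (h.blocks.f_mem m hm))
  rw [e'] at e
  obtain rfl : m' = k := by
    by_contra hne
    exact h.gen.fst_ne hm' hk.1 hne (.inl rfl) (.inr (.inr rfl)) e
  obtain ⟨k', hk', -, hns⟩ := hN
  obtain rfl := Finset.singleton_inj.1 hk'
  exact hns (h.isSink_of_lo_eq_hi (h.mem_trunc hk)
    ((h.gen.own _ hk.1).resolve_right fun hn => hn.1 e.symm))

theorem pt_cut (h : Config O P K f l q) {c : Finset ι} {i : ι} (hc : c ∈ K.idx)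
    (hi : i ∈ O.idx) (h1 : (K.rect c).lo.1 < (P i).1) (h2 : (K.rect c).hi.2 ≤ (P i).2) :
    ∃ e ∈ O.frontSet P, e ≠ c ∧ P i ≤ q e ∧ ((P i).1 < (q e).1 ∨ e = {i}) := by
  obtain ⟨k, hk, hik⟩ := h.exists_onFront hi
  obtain ⟨hN, hne⟩ := h.mem_frontSet_of_reach hc hk (h1.trans_le hik.1) (h2.trans hik.2)
  refine ⟨{k}, hN, hne, by rwa [h.point], ?_⟩
  rw [h.point]
  rcases hik.1.lt_or_eq with hlt | e
  · exact .inl hlt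
  · exact .inr (by rw [h.point_inj hi hk.1 e])

theorem not_le_lo (h : Config O P K f l q) {k : ι} {m : Finset ι} (hk : O.OnFront P k)
    (hkK : {k} ∈ K.idx) (hm : m ∈ K.idx) (hne : m ≠ {k}) : ¬ P k ≤ (K.rect m).lo := fun hle => by
  obtain ⟨i, hi, hle'⟩ := h.exists_lo_le hm
  have hiP := h.lo_le_point hi
  obtain rfl : i = k := by
    by_contra hik
    exact hk.2 i hi hik ((hle.trans hle').trans hiP)
  have e : P i = (K.rect m).lo := le_antisymm hle (hle'.trans hiP)
  exact h.point_notMem hkK hm hne (e ▸ ⟨le_rfl, (K.rect m).le⟩)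

theorem frontSet_idx (h : Config O P K f l q) {e : Finset ι} (he : e ∈ O.frontSet P) :
    e ∈ K.idx := by
  obtain ⟨k, rfl, hk, hs⟩ := he
  exact h.blocks.singleton_mem k (h.mem_trunc hk) hs

theorem searchFamily (h : Config O P K f l q) :
    SearchFamily K q (fun B => ∃ i, B = {i}) (O.frontSet P) where
  gen := h.blocks.generic h.trunc_generic
  ord := h.blocks.ordered
  mem_idx _ he := h.frontSet_idx he
  single := by
    rintro e ⟨k, rfl, -⟩
    exact ⟨k, rfl⟩
  mem := by
    intro e he
    have heK := h.frontSet_idx he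
    obtain ⟨k, rfl, hk, hs⟩ := he
    rw [h.point, Rect.carrier, (h.blocks.rect_singleton heK).1, (h.blocks.rect_singleton heK).2]
    exact h.mem_carrier hk
  notMem := by
    rintro j hj ⟨i, rfl⟩ m hm hne
    rw [h.point]
    exact h.point_notMem hj hm hne
  fst_ne_hi := by
    rintro j hj ⟨i, rfl⟩ m hm hne
    rw [h.point, h.blocks.hi_fst m hm]
    have hl := h.blocks.l_mem m hm
    exact h.gen.fst_ne (h.mem_idx hj (Finset.mem_singleton_self i)) (h.mem_idx hm hl)
      (h.blocks.ne_of_mem hm hj hne hl (Finset.mem_singleton_self i)).symm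
      (.inr (.inr rfl)) (.inr (.inl rfl))
  snd_ne_hi := by
    rintro j hj ⟨i, rfl⟩ m hm hne
    rw [h.point, h.blocks.hi_snd m hm]
    have hl := h.blocks.f_mem m hm
    exact h.gen.snd_ne (h.mem_idx hj (Finset.mem_singleton_self i)) (h.mem_idx hm hl)
      (h.blocks.ne_of_mem hm hj hne hl (Finset.mem_singleton_self i)).symm
      (.inr (.inr rfl)) (.inr (.inl rfl))
  fst_lo := by
    rintro j hj ⟨i, rfl⟩ m hm hne
    rw [h.point, h.blocks.lo_fst m hm, h.blocks.hi_snd m hm]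
    have hf := h.blocks.f_mem m hm
    exact h.point_fst_eq_lo (h.mem_idx hj (Finset.mem_singleton_self i))
      (h.blocks.subset m hm hf)
      (h.blocks.ne_of_mem hm hj hne hf (Finset.mem_singleton_self i)).symm
  snd_lo := by
    rintro j hj ⟨i, rfl⟩ m hm hne
    rw [h.point, h.blocks.lo_snd m hm, h.blocks.hi_fst m hm]
    have hl := h.blocks.l_mem m hm
    have := h.swap.point_fst_eq_lo (i := i) (k := l m)
      (h.mem_idx hj (Finset.mem_singleton_self i))
    rw [trunc_swap] at this
    exact this (h.blocks.subset m hm hl)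
      (h.blocks.ne_of_mem hm hj hne hl (Finset.mem_singleton_self i)).symm
  fst_ne := by
    rintro j hj ⟨i, rfl⟩ m hm ⟨i', rfl⟩ hne
    rw [h.point, h.point]
    exact h.gen.fst_ne (h.mem_idx hj (Finset.mem_singleton_self i))
      (h.mem_idx hm (Finset.mem_singleton_self i')) (fun e => hne (by rw [e]))
      (.inr (.inr rfl)) (.inr (.inr rfl))
  snd_ne := by
    rintro j hj ⟨i, rfl⟩ m hm ⟨i', rfl⟩ hne
    rw [h.point, h.point]
    exact h.gen.snd_ne (h.mem_idx hj (Finset.mem_singleton_self i))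
      (h.mem_idx hm (Finset.mem_singleton_self i')) (fun e => hne (by rw [e]))
      (.inr (.inr rfl)) (.inr (.inr rfl))
  not_le_lo := by
    intro e he m hm hne
    have heK := h.frontSet_idx he
    obtain ⟨k, rfl, hk, hs⟩ := he
    rw [h.point]
    exact h.not_le_lo hk heK hm hne
  not_le_pt := by
    rintro e ⟨k, rfl, hk, hs⟩ m hm ⟨i, rfl⟩ hne
    rw [h.point, h.point]
    exact hk.2 i (h.mem_idx hm (Finset.mem_singleton_self i)) fun e => hne (by rw [e])
  lo_cut_fst c hc m hm h1 h2 := h.lo_cut hc hm h1 h2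
  lo_cut_snd c hc m hm h1 h2 := by
    obtain ⟨e, he, hec, h3, h4⟩ := h.swap.lo_cut hc hm h1 h2
    rw [frontSet_swap] at he
    exact ⟨e, he, hec, ⟨h3.2, h3.1⟩, h4⟩
  pt_cut_fst := by
    rintro c hc m hm ⟨i, rfl⟩
    rw [h.point]
    exact h.pt_cut hc (h.mem_idx hm (Finset.mem_singleton_self i))
  pt_cut_snd := by
    rintro c hc m hm ⟨i, rfl⟩
    rw [h.point]
    intro h1 h2
    obtain ⟨e, he, hec, h3, h4⟩ := h.swap.pt_cut (i := i) hc
      (h.mem_idx hm (Finset.mem_singleton_self i)) h1 h2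
    rw [frontSet_swap] at he
    exact ⟨e, he, hec, ⟨h3.2, h3.1⟩, h4⟩

/-- If a region of the canonical set is dominated by the point of another region, then it is
dominated by a point of the front set. -/
theorem not_hi_le_point (h : Config O P K f l q) {c : Finset ι} (hc : c ∈ K.idx)
    (hu : K.Undominated q (O.frontSet P) c) {j : ι} (hj : j ∈ O.idx) (hjc : {j} ≠ c) :
    ¬ (K.rect c).hi ≤ P j := fun hle => by
  obtain ⟨k, hk, hjk⟩ := h.exists_onFront hj
  have hle' := hle.trans hjk
  have hkR := h.mem_trunc hk
  have hkP := h.point_le_hi hk.1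
  have hf := h.blocks.f_mem c hc
  have hfR := h.blocks.subset c hc hf
  have hl := h.blocks.l_mem c hc
  have hlR := h.blocks.subset c hc hl
  have h1 := hle'.1
  have h2 := hle'.2
  rw [h.blocks.hi_fst c hc] at h1
  rw [h.blocks.hi_snd c hc] at h2
  have hlf : (O.trunc.rect (f c)).lo.1 ≤ (O.trunc.rect (l c)).lo.1 := by
    rcases h.blocks.last c hc _ hf with e | e
    exacts [(congrArg (fun i => (O.trunc.rect i).lo.1) e).le, e.2.2.1]
  have hll := (O.trunc.rect (l c)).le.1
  have hne : k ≠ f c := by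
    rintro hkc
    subst hkc
    have e : f c = l c := by
      by_contra hne
      have hb := (h.blocks.last c hc _ hf).resolve_left hne
      have hs : O.trunc.IsSink (f c) := by
        rcases h.blocks.sink_or c hc with ⟨i, hi, -⟩ | hs
        · rw [hi, Finset.mem_singleton] at hf hl
          exact absurd (hi ▸ hf.trans hl.symm) hne
        · exact hs _ hf
      have h3 := (((isSink_iff h.trunc_generic h.trunc_ordered).1 hs).2 _).1 hb
      exact h.trunc_generic.hi_fst _ hfR _ hlR hne
        (le_antisymm (h3.trans hll) (h1.trans hkP.1))
    have hcs := h.blocks.eq_singleton hc e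
    rw [← e] at h1
    have hj1 := hle.1
    rw [h.blocks.hi_fst c hc, ← e] at hj1
    have := h.point_inj hj hk.1 (le_antisymm hjk.1 (hkP.1.trans hj1))
    exact hjc (this ▸ hcs.symm)
  have hns : ¬ O.trunc.IsSink k := by
    rcases h.trunc_ordered k hkR _ hfR hne with hb | hb
    · refine h.not_isSink_fst hb (lt_of_le_of_lt (hlf.trans hll)
        (lt_of_le_of_ne (h1.trans hkP.1) (h.trunc_generic.hi_fst _ hlR k hkR ?_)))
      rcases h.blocks.last c hc _ hf with e | e
      · exact e ▸ hne.symm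
      · exact (hb.trans e).ne.symm
    · exact h.not_isSink_snd hb (lt_of_le_of_lt (O.trunc.rect (f c)).le.2
        (lt_of_le_of_ne (h2.trans hkP.2) (h.trunc_generic.hi_snd _ hfR k hkR hne.symm)))
  refine hu {k} ⟨k, rfl, hk, hns⟩ ?_ (by rwa [h.point])
  rintro rfl
  exact hne (h.blocks.singleton_eq hc).1.symm

end Config

/-! ### Good regions -/

theorem inter_frontier_nonempty {α : Type*} [TopologicalSpace α] {s D : Set α}
    (hs : IsPreconnected s) (h : (s ∩ D).Nonempty) (h' : (s ∩ Dᶜ).Nonempty) :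
    (s ∩ frontier D).Nonempty := by
  rw [frontier_eq_closure_inter_closure]
  refine isPreconnected_closed_iff.1 hs _ _ isClosed_closure isClosed_closure (fun z _ => ?_)
    (h.mono (Set.inter_subset_inter_right _ subset_closure))
    (h'.mono (Set.inter_subset_inter_right _ subset_closure))
  by_cases hz : z ∈ D
  exacts [.inl (subset_closure hz), .inr (subset_closure hz)]

theorem vSet_of_isSink {R : RegionSet ι} (P : ι → ℝ × ℝ) {i : ι} (hi : R.IsSink i) :
    R.vSet P i = {i} := by
  classical
  rw [vSet, Finset.filter_eq_empty_iff.2 fun k _ hk => hi.2 k (.inl hk.1)]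
  rfl

theorem hSet_of_isSink {R : RegionSet ι} (P : ι → ℝ × ℝ) {i : ι} (hi : R.IsSink i) :
    R.hSet P i = {i} := by
  classical
  rw [hSet, Finset.filter_eq_empty_iff.2 fun k _ hk => hi.2 k (.inr hk.1)]
  rfl

theorem vCard_of_isSink {R : RegionSet ι} (P : ι → ℝ × ℝ) {B : Finset ι}
    (hB : ∀ i ∈ B, R.IsSink i) : R.vCard P B = 1 := by
  classical
  rw [vCard, Nat.add_eq_left, Finset.card_eq_zero, Finset.sdiff_eq_empty_iff_subset,
    Finset.biUnion_subset]
  intro i hi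
  rw [vSet_of_isSink P (hB i hi)]
  exact Finset.singleton_subset_iff.2 hi

theorem hCard_of_isSink {R : RegionSet ι} (P : ι → ℝ × ℝ) {B : Finset ι}
    (hB : ∀ i ∈ B, R.IsSink i) : R.hCard P B = 1 := by
  classical
  rw [hCard, Nat.add_eq_left, Finset.card_eq_zero, Finset.sdiff_eq_empty_iff_subset,
    Finset.biUnion_subset]
  intro i hi
  rw [hSet_of_isSink P (hB i hi)]
  exact Finset.singleton_subset_iff.2 hi

namespace Config

variable {O : RegionSet ι} {P : ι → ℝ × ℝ} {K : RegionSet (Finset ι)} {f l : Finset ι → ι}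
  {q : Finset ι → ℝ × ℝ}

/-- A region of the canonical set is good if it is a single region that is not a sink, and is not
dominated as a whole. The good regions are interesting in the sense of the Pareto cost function. -/
def Good (O : RegionSet ι) (P : ι → ℝ × ℝ) (K : RegionSet (Finset ι)) (q : Finset ι → ℝ × ℝ)
    (B : Finset ι) : Prop :=
  B ∈ K.idx ∧ K.Undominated q (O.frontSet P) B ∧ ∃ i, B = {i} ∧ ¬ O.trunc.IsSink i

/-- A good region meets the Pareto front: its bottom left vertex is dominated by a point, its top
right vertex is not. -/
theorem Good.isInteresting (h : Config O P K f l q) {i : ι} (hi : Good O P K q {i}) :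
    O.IsInteresting P i := by
  obtain ⟨hK, hu, i', hi', hs⟩ := hi
  obtain rfl := Finset.singleton_inj.1 hi'
  have hiR := h.blocks.subset _ hK (Finset.mem_singleton_self i)
  refine ⟨hiR, ?_, .inr (.inr hs)⟩
  obtain ⟨m, hm, hle⟩ := exists_trunc_lo_le O (mem_trunc_idx.1 hiR).1
  refine inter_frontier_nonempty (convex_Icc _ _).isPreconnected
    ⟨(O.trunc.rect i).lo, ⟨le_rfl, (O.trunc.rect i).le⟩, m, hm, hle.trans (h.lo_le_point hm)⟩
    ⟨(O.trunc.rect i).hi, ⟨(O.trunc.rect i).le, le_rfl⟩, ?_⟩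
  rintro ⟨j, hj, hle⟩
  by_cases hji : j = i
  · subst hji
    exact hs (h.isSink_of_lo_eq_hi hiR ((h.gen.own j hj).resolve_right fun hn =>
      hn.2.1 (le_antisymm (h.point_le_hi hj).1 hle.1)))
  · refine h.not_hi_le_point hK hu hj (fun e => hji (Finset.singleton_inj.1 e)) ?_
    rwa [(h.blocks.rect_singleton hK).2]

theorem good_of_mem_frontSet (h : Config O P K f l q) {e : Finset ι} (he : e ∈ O.frontSet P) :
    Good O P K q e := by
  have hF := h.searchFamily
  obtain ⟨k, hk, -, hs⟩ := id he
  exact ⟨h.frontSet_idx he, fun e' he' hne hle => hF.not_le_pt e he e' (hF.mem_idx e' he')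
    (hF.single e' he') hne ((hF.mem e he).2.trans hle), k, hk, hs⟩

theorem good_of_isSource (h : Config O P K f l q) {B : Finset ι} (hB : K.IsSource B) :
    Good O P K q B :=
  ⟨hB.1, (h.searchFamily.settled_of_isSource (D := ∅) hB).undominated,
    (h.blocks.sink_or B hB.1).resolve_right fun hs =>
      h.blocks.not_isSource h.trunc_generic h.trunc_ordered hB.1 hs hB⟩

/-- A point before an undominated block of sinks cannot dominate a region after this block. -/
theorem not_before_of_hi_le (h : Config O P K f l q) {x m e : Finset ι}
    (hs : ∀ i ∈ x, O.trunc.IsSink i) (hu : K.Undominated q (O.frontSet P) x)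
    (hb : K.Before x m) (he : e ∈ O.frontSet P) (hle : (K.rect m).hi ≤ q e) :
    ¬ K.Before e x := fun hex => by
  have h1 := h.blocks.hi_le_lo_of_sinks h.trunc_generic h.trunc_ordered hs hb
  have h2 := (K.rect m).le.1
  have h3 := (K.rect x).le.1
  have hm := h.searchFamily.mem e he
  have h4 := hle.1
  have h5 := hm.2.1
  have hsep := (h.searchFamily.gen.disj.sep hex).resolve_left (by linarith)
  exact hu e he hex.ne ⟨by linarith, hsep.le.trans hm.1.2⟩

/-- Between two undominated blocks of sinks there is a good region: some region between them is
not a sink, and if it is dominated, then by the point of a good region between them. -/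
theorem exists_good_between (h : Config O P K f l q) {x y : Finset ι}
    (hsx : ∀ i ∈ x, O.trunc.IsSink i) (hsy : ∀ i ∈ y, O.trunc.IsSink i)
    (hux : K.Undominated q (O.frontSet P) x) (huy : K.Undominated q (O.frontSet P) y)
    (hb : K.Before x y) : ∃ g, Good O P K q g ∧ K.Before x g ∧ K.Before g y := by
  obtain ⟨k, hk, hks, hxk, hky⟩ := h.blocks.split x hb.1 y hb.2.1 hsx hsy fun s hs t ht =>
    h.blocks.before_of_before hb hs ht
  have hkK := h.blocks.singleton_mem k hk hks
  have hxk' : K.Before x {k} := h.blocks.before_of_forall hb.1 hkK fun s hs t ht =>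
    Finset.mem_singleton.1 ht ▸ hxk s hs
  have hky' : K.Before {k} y := h.blocks.before_of_forall hkK hb.2.1 fun s hs t ht =>
    Finset.mem_singleton.1 hs ▸ hky t ht
  by_cases hu : K.Undominated q (O.frontSet P) {k}
  · exact ⟨{k}, ⟨hkK, hu, k, rfl, hks⟩, hxk', hky'⟩
  simp only [Undominated, not_forall, not_not] at hu
  obtain ⟨e, he, hek, hle⟩ := hu
  have heK := h.frontSet_idx he
  have hne : ∀ z : Finset ι, (∀ i ∈ z, O.trunc.IsSink i) → z ≠ e := by
    rintro z hz rfl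
    obtain ⟨i, rfl, -, hs⟩ := he
    exact hs (hz i (Finset.mem_singleton_self i))
  refine ⟨e, h.good_of_mem_frontSet he, ?_, ?_⟩
  · exact (h.blocks.ordered x hb.1 e heK (hne x hsx)).resolve_right
      (h.not_before_of_hi_le hsx hux hxk' he hle)
  · refine (h.blocks.ordered y hb.2.1 e heK (hne y hsy)).resolve_left fun hye => ?_
    refine h.swap.not_before_of_hi_le (x := y) (m := {k}) (e := e) ?_ ?_ (before_swap.2 hky') ?_
      ⟨hle.2, hle.1⟩ (before_swap.2 hye)
    · simp only [trunc_swap, isSink_swap]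
      exact hsy
    · rw [frontSet_swap]
      exact undominated_swap.2 huy
    · rwa [frontSet_swap]

end Config

/-! ### Executions of the algorithm -/

open scoped Classical in
/-- The point that replaces a region of the canonical set when it is processed, with the junk value
`0` for a compound region. -/
noncomputable def blockPoint (P : ι → ℝ × ℝ) (B : Finset ι) : ℝ × ℝ :=
  if h : ∃ i, B = {i} then P h.choose else 0

theorem blockPoint_singleton (P : ι → ℝ × ℝ) (i : ι) : blockPoint P {i} = P i := by
  have h : ∃ j, ({i} : Finset ι) = {j} := ⟨i, rfl⟩
  rw [blockPoint, dif_pos h, ← Finset.singleton_inj.1 h.choose_spec]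

theorem current_eq (K : RegionSet (Finset ι)) (P : ι → ℝ × ℝ) (D : Finset (Finset ι)) :
    current K P D = (reveal K (blockPoint P) (fun B => ∃ i, B = {i}) D).trunc := by
  rw [current, reveal]
  congr 2
  funext B
  by_cases h : B ∈ D ∧ ∃ i, B = {i}
  · rw [dif_pos h, if_pos h, blockPoint, dif_pos h.2]
  · rw [dif_neg h, if_neg h]

/-- Some source of the initial dependency graph is `c` or precedes `c`. -/
def Rooted (K : RegionSet (Finset ι)) (c : Finset ι) : Prop :=
  ∃ r, K.IsSource r ∧ (r = c ∨ K.Before r c)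

/-- The invariant of the states of the algorithm. -/
structure GoodState (K : RegionSet (Finset ι)) (P : ι → ℝ × ℝ) (N : Set (Finset ι))
    (s : AlgState ι) : Prop where
  processed : ∀ B ∈ s.processed, Settled K (blockPoint P) N s.processed B
  queue : ∀ a b, (a, b) ∈ s.queue →
    (Settled K (blockPoint P) N s.processed a ∧ Rooted K a) ∧
    (Settled K (blockPoint P) N s.processed b ∧ Rooted K b)

theorem GoodState.step {K : RegionSet (Finset ι)} {P : ι → ℝ × ℝ} {N : Set (Finset ι)}
    (hK : SearchFamily K (blockPoint P) (fun B => ∃ i, B = {i}) N) {s s' : AlgState ι}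
    (h : GoodState K P N s) (hs : IsStep K P s s') : GoodState K P N s' := by
  classical
  rcases hs with ⟨-, rfl⟩ | ⟨a, b, Q, new, hq, hp, hq', -, hnew⟩
  · exact h
  obtain ⟨⟨ha, hra⟩, hb, hrb⟩ := h.queue a b (by simp [hq])
  have hsub : s.processed ⊆ s'.processed := fun B hB => by
    rw [hp]
    exact Finset.mem_union_left _ hB
  have haD : a ∈ s'.processed := by simp [hp]
  have hbD : b ∈ s'.processed := by simp [hp]
  have hproc : ∀ B ∈ s'.processed, Settled K (blockPoint P) N s'.processed B := fun B hB => by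
    rw [hp] at hB
    simp only [Finset.mem_union, Finset.mem_insert, Finset.mem_singleton] at hB
    rcases hB with hB | rfl | rfl
    · exact (h.processed B hB).mono hsub
    · exact ha.mono hsub
    · exact hb.mono hsub
  have hchild : ∀ c, K.Before a c → K.Before c b →
      (interval K (current K P s'.processed) a b).IsSource c →
      Settled K (blockPoint P) N s'.processed c ∧ Rooted K c := fun c hac hcb hc => by
    constructor
    · by_cases hcD : c ∈ s'.processed
      · exact hproc c hcD
      rw [current_eq] at hc
      exact ChildSituation.settled (a := a) (b := b) (T := interval K _ a b) {
        fam := hK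
        settled_left := ha.mono hsub
        settled_right := hb.mono hsub
        left_mem := haD
        right_mem := hbD
        before_left := hac
        before_right := hcb
        notMem := hcD
        subset := Finset.filter_subset _ _
        rect := rfl
        between := fun B hB h1 h2 => Finset.mem_filter.2 ⟨hB, .inr (.inr ⟨h1, h2⟩)⟩
        isSource := hc }
    · obtain ⟨r, hr, hra⟩ := hra
      refine ⟨r, hr, .inr ?_⟩
      rcases hra with rfl | hra
      exacts [hac, hra.trans hac]
  refine ⟨hproc, fun c d hcd => ?_⟩
  rw [hq', List.mem_append] at hcd
  rcases hcd with hcd | hcd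
  · obtain ⟨⟨h2, h3⟩, h4, h5⟩ := h.queue c d (by simp [hq, hcd])
    exact ⟨⟨h2.mono hsub, h3⟩, h4.mono hsub, h5⟩
  · obtain ⟨⟨hc, hd, -⟩, -⟩ := (hnew c d).1 hcd
    rw [← hp] at hc hd
    refine ⟨?_, ?_⟩
    · rcases hc with rfl | ⟨h1, h2, h3⟩
      exacts [⟨ha.mono hsub, hra⟩, hchild c h1 h2 h3]
    · rcases hd with rfl | ⟨h1, h2, h3⟩
      exacts [⟨hb.mono hsub, hrb⟩, hchild d h1 h2 h3]

theorem IsExecution.goodState {K : RegionSet (Finset ι)} {P : ι → ℝ × ℝ} {N : Set (Finset ι)}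
    (hK : SearchFamily K (blockPoint P) (fun B => ∃ i, B = {i}) N) {s : ℕ → AlgState ι}
    (hs : IsExecution K P s) (t : ℕ) : GoodState K P N (s t) := by
  obtain ⟨hp, -, hq, hstep⟩ := hs
  induction t with
  | zero =>
    refine ⟨fun B hB => by simp [hp] at hB, fun a b hab => ?_⟩
    obtain ⟨-, h1, h2, -⟩ := (hq a b).1 hab
    exact ⟨⟨hK.settled_of_isSource h1, a, h1, .inl rfl⟩,
      hK.settled_of_isSource h2, b, h2, .inl rfl⟩
  | succ t ih => exact ih.step hK (hstep t)

theorem IsExecution.undominated_and_rooted {K : RegionSet (Finset ι)} {P : ι → ℝ × ℝ}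
    {N : Set (Finset ι)}
    (hK : SearchFamily K (blockPoint P) (fun B => ∃ i, B = {i}) N) {s : ℕ → AlgState ι}
    (hs : IsExecution K P s) {B : Finset ι} (hB : IsEndpoint K s B) :
    K.Undominated (blockPoint P) N B ∧ Rooted K B := by
  obtain ⟨t, a, b, hhead, -, hB⟩ := hB
  obtain ⟨ha, hb⟩ := (hs.goodState hK t).queue a b (List.mem_of_head? hhead)
  rcases hB with rfl | rfl
  exacts [⟨ha.1.undominated, ha.2⟩, ⟨hb.1.undominated, hb.2⟩]

/-! ### Charging the costs -/

/-- If elements of `G` alternate with elements of `X` on a line, starting in `G`, then `X` has at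
most as many elements as `G`. -/
theorem card_le_card_of_interleaved {α : Type*} {X G : Finset α} (p : α → ℝ)
    (hinj : Set.InjOn p X) (h1 : ∀ x ∈ X, ∃ g ∈ G, p g < p x)
    (h2 : ∀ x ∈ X, ∀ y ∈ X, p x < p y → ∃ g ∈ G, p x < p g ∧ p g < p y) :
    X.card ≤ G.card := by
  classical
  have hex : ∀ x ∈ X, ∃ g ∈ G, p g < p x ∧ ∀ g' ∈ G, p g' < p x → p g' ≤ p g := fun x hx => by
    obtain ⟨g₀, hg₀, hlt⟩ := h1 x hx
    obtain ⟨g, hg, hmax⟩ := Finset.exists_max_image (G.filter fun g => p g < p x) p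
      ⟨g₀, Finset.mem_filter.2 ⟨hg₀, hlt⟩⟩
    exact ⟨g, (Finset.mem_filter.1 hg).1, (Finset.mem_filter.1 hg).2, fun g' hg' hlt' =>
      hmax g' (Finset.mem_filter.2 ⟨hg', hlt'⟩)⟩
  choose! φ hφG hφlt hφmax using hex
  have key : ∀ x ∈ X, ∀ y ∈ X, p x < p y → φ x ≠ φ y := fun x hx y hy hxy e => by
    obtain ⟨g, hg, hxg, hgy⟩ := h2 x hx y hy hxy
    have := hφmax y hy g hg hgy
    rw [← e] at this
    exact (hxg.trans_le this).not_gt (hφlt x hx)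
  refine Finset.card_le_card_of_injOn φ hφG fun x hx y hy e => ?_
  rcases lt_trichotomy (p x) (p y) with h | h | h
  · exact absurd e (key x hx y hy h)
  · exact hinj hx hy h
  · exact absurd e.symm (key y hy x hx h)

theorem logb_natCast_nonneg (n : ℕ) : 0 ≤ Real.logb 2 n := by
  rcases Nat.eq_zero_or_pos n with rfl | hn
  · simp
  · exact Real.logb_nonneg one_lt_two (by exact_mod_cast hn)

theorem algCost_le_paretoCost [Nonempty ι] {O : RegionSet ι} (hO : O.PairwiseDisjoint)
    {P : ι → ℝ × ℝ} (hP : O.Respects P) (hgen : O.GeneralPosition P) {C : ℝ} (hC : 0 ≤ C)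
    {s : ℕ → AlgState ι} (hs : IsExecution O.trunc.canonical P s) :
    O.algCost P C s ≤ O.paretoCost P C := by
  classical
  obtain ⟨f, l, hB⟩ := exists_blocks (generic_trunc (hgen.generic hO)) (ordered_trunc hO)
  have h : Config O P O.trunc.canonical f l (blockPoint P) :=
    ⟨hO, hP, hgen, hB, blockPoint_singleton P⟩
  set K := O.trunc.canonical with hK
  set L : Finset ι → ℝ := fun B =>
    Real.logb 2 (O.trunc.vCard P B) + Real.logb 2 (O.trunc.hCard P B) with hL
  have hL0 : ∀ B, 0 ≤ L B := fun B =>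
    add_nonneg (logb_natCast_nonneg _) (logb_natCast_nonneg _)
  set A := K.idx.filter (IsEndpoint K s) with hA
  set G := K.idx.filter (Config.Good O P K (blockPoint P)) with hG
  have hAu : ∀ B ∈ A, B ∈ K.idx ∧ K.Undominated (blockPoint P) (O.frontSet P) B ∧
      Rooted K B := fun B hBA => by
    obtain ⟨h1, h2⟩ := Finset.mem_filter.1 hBA
    exact ⟨h1, hs.undominated_and_rooted h.searchFamily h2⟩
  have hsink : ∀ B ∈ A \ G, ∀ i ∈ B, O.trunc.IsSink i := fun B hBA => by
    obtain ⟨hBA, hBG⟩ := Finset.mem_sdiff.1 hBA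
    obtain ⟨h1, h2, -⟩ := hAu B hBA
    exact (hB.sink_or B h1).resolve_left fun h3 =>
      hBG (Finset.mem_filter.2 ⟨h1, h1, h2, h3⟩)
  have hcard : (A \ G).card ≤ G.card := by
    refine card_le_card_of_interleaved K.pos (fun x hx y hy e => ?_) (fun x hx => ?_)
      fun x hx y hy hxy => ?_
    · exact hB.ordered.pos_inj (hAu x (Finset.mem_sdiff.1 hx).1).1
        (hAu y (Finset.mem_sdiff.1 hy).1).1 e
    · obtain ⟨-, -, r, hr, hrx⟩ := hAu x (Finset.mem_sdiff.1 hx).1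
      have hrG : r ∈ G := Finset.mem_filter.2 ⟨hr.1, h.good_of_isSource hr⟩
      rcases hrx with rfl | hrx
      · exact absurd hrG (Finset.mem_sdiff.1 hx).2
      · exact ⟨r, hrG, hrx.pos_lt⟩
    · obtain ⟨hxK, hxu, -⟩ := hAu x (Finset.mem_sdiff.1 hx).1
      obtain ⟨hyK, hyu, -⟩ := hAu y (Finset.mem_sdiff.1 hy).1
      obtain ⟨g, hg, h1, h2⟩ := h.exists_good_between (hsink x hx) (hsink y hy) hxu hyu
        ((hB.ordered.before_iff hxK hyK).2 hxy)
      exact ⟨g, Finset.mem_filter.2 ⟨hg.1, hg⟩, h1.pos_lt, h2.pos_lt⟩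
  have halg : O.algCost P C s = ∑ B ∈ A, (C / 2 + L B) :=
    Finset.sum_congr rfl fun B _ => add_assoc _ _ _
  have hpar : O.paretoCost P C =
      ∑ B ∈ (O.trunc.idx.filter (O.IsInteresting P)).image (fun i => ({i} : Finset ι)),
        (C + L B) := by
    rw [Finset.sum_image fun i _ j _ e => Finset.singleton_inj.1 e]
    refine Finset.sum_congr rfl fun i _ => ?_
    rw [hL, add_assoc]
    simp only [vCard_singleton, hCard_singleton]
  have hGsub : G ⊆ (O.trunc.idx.filter (O.IsInteresting P)).image
      (fun i => ({i} : Finset ι)) := fun B hBG => by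
    have hBG := (Finset.mem_filter.1 hBG).2
    obtain ⟨-, -, i, rfl, -⟩ := id hBG
    have hi := hBG.isInteresting h
    exact Finset.mem_image.2 ⟨i, Finset.mem_filter.2 ⟨hi.1, hi⟩, rfl⟩
  have hsdiff : ∑ B ∈ A \ G, (C / 2 + L B) = (A \ G).card * (C / 2) := by
    rw [← nsmul_eq_mul, ← Finset.sum_const]
    refine Finset.sum_congr rfl fun B hBA => ?_
    simp [hL, vCard_of_isSink P (hsink B hBA), hCard_of_isSink P (hsink B hBA)]
  rw [halg, hpar]
  calc ∑ B ∈ A, (C / 2 + L B)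
      = ∑ B ∈ A ∩ G, (C / 2 + L B) + ∑ B ∈ A \ G, (C / 2 + L B) :=
        (Finset.sum_inter_add_sum_sdiff _ _ _).symm
    _ ≤ ∑ B ∈ G, (C / 2 + L B) + G.card * (C / 2) := by
        rw [hsdiff]
        refine add_le_add (Finset.sum_le_sum_of_subset_of_nonneg Finset.inter_subset_right
          fun B _ _ => add_nonneg (by linarith) (hL0 B)) ?_
        exact mul_le_mul_of_nonneg_right (by exact_mod_cast hcard) (by linarith)
    _ = ∑ B ∈ G, (C + L B) := by
        rw [← nsmul_eq_mul, ← Finset.sum_const, ← Finset.sum_add_distrib]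
        exact Finset.sum_congr rfl fun B _ => by ring
    _ ≤ _ := Finset.sum_le_sum_of_subset_of_nonneg hGsub fun B _ _ => add_nonneg hC (hL0 B)

end RegionSet

theorem mainTheorem4 {ι : Type*} (O : RegionSet ι) (hO : O.PairwiseDisjoint)
    (P : ι → ℝ × ℝ) (hP : O.Respects P) (hgen : O.GeneralPosition P)
    (C : ℝ) (hC : 0 ≤ C)
    (s : ℕ → RegionSet.AlgState ι) (hs : RegionSet.IsExecution O.trunc.canonical P s) :
    O.algCost P C s ≤ O.paretoCost P C := by
  classical
  rcases isEmpty_or_nonempty ι with hι | hι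
  · have h : O.trunc.canonical.idx = ∅ := by
      simp [RegionSet.canonical, Finset.eq_empty_of_isEmpty]
    rw [RegionSet.algCost, RegionSet.paretoCost, h, Finset.eq_empty_of_isEmpty O.trunc.idx]
    simp
  · exact RegionSet.algCost_le_paretoCost hO hP hgen hC hs
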